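/- For a word $x$ of length $n$ over an alphabet $\Sigma$, let $A_N(x)$ (the nondeterministic automatic complexity) be the least number of states of a nondeterministic finite automaton, with a single initial state, that accepts $x$ and has only one accepting path of length $n$ (a path being a sequence of labelled edges). Let $\mathcal C\subseteq\{\mathtt 0,\mathtt 1\}^*$ be the decision problem whose output on $x$ is the most significant bit of $A_N(x)$: since the largest value of $A_N$ on words of length $n$ over arbitrary alphabets is $\lfloor n/2\rfloor+1$, the number $A_N(x)$ is written with as many binary digits as $\lfloor n/2\rfloor+1$, and $x\in\mathcal C$ iff the digit of $A_N(x)$ of weight $2^{\lfloor\log_2(\lfloor n/2\rfloor+1)\rfloor}$ is $1$. Let $\mathsf{SAC}^0$ be the class of languages $L\subseteq\{\mathtt 0,\mathtt 1\}^*$ decided by (nonuniform) families of Boolean circuits of constant depth and polynomial size whose gates are constants, input bits and their negations, AND gates of fan-in two, and OR gates of unbounded fan-in. Let $\mathsf{coSAC}^0$ be the class of complements of languages in $\mathsf{SAC}^0$. A language is $\mathsf{SAC}^0$-immune if it is infinite and has no infinite subset in $\mathsf{SAC}^0$; it is $\mathsf{coSAC}^0$-immune, in the sense meant here (also called $\mathsf{SAC}^0$-coimmune),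 if its complement is $\mathsf{SAC}^0$-immune. **Theorem.** $\mathcal C$ is $\mathsf{SAC}^0$-immune and $\mathsf{coSAC}^0$-immune: $\mathcal C$ and its complement are both infinite, and neither has an infinite subset in $\mathsf{SAC}^0$. In particular $\mathcal C\notin\mathsf{SAC}^0$ and $\mathcal C\notin\mathsf{coSAC}^0$. -/

import Mathlib

/-! ### Nondeterministic automatic complexity -/

/-- The state sequence `s` together with the word `w` read along it is an accepting path of length
`n` in `M`. A path is a sequence of labelled edges, so parallel edges with distinct labels count as
distinct. -/
def IsAcceptingPath {α σ : Type*} (M : NFA α σ) (n : ℕ) (s : Fin (n + 1) → σ) (w : Fin n → α) :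
    Prop :=
  s 0 ∈ M.start ∧ s (Fin.last n) ∈ M.accept ∧
    ∀ i : Fin n, s i.succ ∈ M.step (s i.castSucc) (w i)

/-- `M` has a single initial state, it accepts `x`, and it has only one accepting path of length
`|x|`. -/
def IsWitness {α σ : Type*} (M : NFA α σ) (x : List α) : Prop :=
  (∃ q₀, M.start = {q₀}) ∧
    ∃ s : Fin (x.length + 1) → σ, IsAcceptingPath M x.length s x.get ∧
      ∀ s' w', IsAcceptingPath M x.length s' w' → s' = s ∧ w' = x.get

/-- The nondeterministic automatic complexity `A_N(x)`: the least number of states of a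
nondeterministic finite automaton which accepts `x` and has only one accepting path of length
`|x|`. -/
noncomputable def automaticComplexity {α : Type*} (x : List α) : ℕ :=
  sInf {q : ℕ | ∃ M : NFA α (Fin q), IsWitness M x}

/-- The minimum defining `automaticComplexity` is attained: a path-shaped automaton is a witness. -/
theorem exists_isWitness_automaticComplexity {α : Type*} (x : List α) :
    ∃ M : NFA α (Fin (automaticComplexity x)), IsWitness M x := by
  have hne : {q : ℕ | ∃ M : NFA α (Fin q), IsWitness M x}.Nonempty := by
    refine ⟨x.length + 1, ⟨fun p a => {r | ∃ i : Fin x.length, p = i.castSucc ∧ r = i.succ ∧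
      a = x.get i}, {0}, Set.univ⟩, ⟨0, rfl⟩, id, ⟨rfl, trivial, fun i => ⟨i, rfl, rfl, rfl⟩⟩, ?_⟩
    rintro s' w' ⟨h0, -, hstep⟩
    have hs : s' = id := by
      funext j
      induction j using Fin.induction with
      | zero => exact h0
      | succ i ih =>
        obtain ⟨k, hk, hk', -⟩ := hstep i
        rw [ih] at hk
        have : i = k := Fin.castSucc_injective _ hk
        rw [hk', this, id]
    refine ⟨hs, ?_⟩
    funext i
    obtain ⟨k, hk, -, hw⟩ := hstep i
    rw [hs] at hk
    have : i = k := Fin.castSucc_injective _ hk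
    rw [hw, this]
  exact Nat.sInf_mem hne

/-- The decision problem `𝒞`: the most significant bit of `A_N(x)` is `1`. On words of length `n`
the largest value of `A_N` is `⌊n / 2⌋ + 1`, so `A_N(x)` is written in binary with the number of
digits of `⌊n / 2⌋ + 1`, and the most significant digit is the one of weight
`2 ^ ⌊log₂ (⌊n / 2⌋ + 1)⌋`. -/
def msbProblem : Set (List Bool) :=
  {x | (automaticComplexity x).testBit (Nat.log 2 (x.length / 2 + 1)) = true}

/-! ### Semi-unbounded fan-in circuits -/

/-- A gate over `n` input bits, which may use the values of `k` earlier gates: a constant, an input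
bit or its negation, a binary AND, or an OR of any number of earlier gates. -/
inductive SACGate (n k : ℕ) : Type
  | const (b : Bool)
  | input (i : Fin n)
  | negInput (i : Fin n)
  | and (a b : Fin k)
  | or (S : Finset (Fin k))

/-- A semi-unbounded fan-in circuit with `n` inputs: an acyclic list of gates, one of which is the
output. -/
structure SACCircuit (n : ℕ) where
  size : ℕ
  gate : (k : Fin size) → SACGate n k
  output : Fin size

namespace SACCircuit

/-- Gate `k` of the circuit evaluates to true on the input `x`. -/
def Holds {n : ℕ} (C : SACCircuit n) (x : Fin n → Bool) (k : Fin C.size) : Prop :=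
  match C.gate k with
  | .const b => b = true
  | .input i => x i = true
  | .negInput i => x i = false
  | .and a b => C.Holds x ⟨a, a.2.trans k.2⟩ ∧ C.Holds x ⟨b, b.2.trans k.2⟩
  | .or S => ∃ a ∈ S, C.Holds x ⟨a, a.2.trans k.2⟩
termination_by k.val

/-- The depth of gate `k`: the largest number of AND and OR gates on a path ending in it. -/
def gateDepth {n : ℕ} (C : SACCircuit n) (k : Fin C.size) : ℕ :=
  match C.gate k with
  | .const _ => 0
  | .input _ => 0
  | .negInput _ => 0
  | .and a b =>
      max (C.gateDepth ⟨a, a.2.trans k.2⟩) (C.gateDepth ⟨b, b.2.trans k.2⟩) + 1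
  | .or S => (S.sup fun a => C.gateDepth ⟨a, a.2.trans k.2⟩) + 1
termination_by k.val

/-- The circuit accepts the input `x`. -/
def Accepts {n : ℕ} (C : SACCircuit n) (x : Fin n → Bool) : Prop :=
  C.Holds x C.output

/-- The depth of the circuit. -/
def depth {n : ℕ} (C : SACCircuit n) : ℕ :=
  C.gateDepth C.output

end SACCircuit

/-- The class `SAC⁰` (nonuniform): languages decided by families of semi-unbounded fan-in circuits
of constant depth and polynomial size. -/
def SAC0 : Set (Set (List Bool)) :=
  {L | ∃ (d e : ℕ) (C : (n : ℕ) → SACCircuit n),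
    (∀ n, (C n).depth ≤ d ∧ (C n).size ≤ n ^ e + e) ∧
      ∀ x : List Bool, x ∈ L ↔ (C x.length).Accepts x.get}

/-- The class `coSAC⁰` of complements of languages in `SAC⁰`. -/
def coSAC0 : Set (Set (List Bool)) :=
  {L | Lᶜ ∈ SAC0}

/-! ### Immunity -/

/-- `L` is immune for the class `𝒦`: it is infinite and has no infinite subset in `𝒦`. -/
def IsImmune (𝒦 : Set (Set (List Bool))) (L : Set (List Bool)) : Prop :=
  L.Infinite ∧ ∀ S ∈ 𝒦, S ⊆ L → S.Finite

/-- `L` is coimmune for the class `𝒦`: its complement is immune for `𝒦`. -/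
def IsCoimmune (𝒦 : Set (Set (List Bool))) (L : Set (List Bool)) : Prop :=
  IsImmune 𝒦 Lᶜ

/-!
A circuit of depth `d` in which only OR gates have unbounded fan-in accepts a word because of at
most `2 ^ d` of its letters (`SACCircuit.exists_certificate`). So an infinite language in `SAC⁰`
contained in the problem `𝒞`, or in its complement, would give arbitrarily long words in which
boundedly many letters force membership. It therefore suffices to extend few prescribed letters of a
long word to a word outside of `𝒞`, and to a word in `𝒞`.

For the former, there is a number `k` between `n / 8` and `n / 4` modulo which the prescribed
positions are pairwise incongruent, and a word of period `k` is read by a cycle of `k` states.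

For the latter, the folded automaton shows that the complexity is at most `n / 2 + 1`
(`automaticComplexity_le_half`), and this value has its most significant bit set. It is attained by
every word in which long factors do not repeat (`HasDistinctFactors`) and which has no deep nests of
blocks (`IsNest`); a union bound (`exists_generic_extension`) provides such a word with the
prescribed letters. The lower bound `IsUniquePath.le_two_mul_card` only uses that the accepting path
is unique, so that rearranging the path, or replacing a closed part of it by other closed walks of
the same total length, has to give the same path.

* Suppose that there are at most `n / 2` states. Then some state is visited three times. Short
  returns of the path to a state are rare, as two of the same length in different places could be
  traded for each other; counting visits, almost all states are visited exactly twice, at distant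
  times, which form a chord (`card_badTimes_le`).
* Crossing chords repeat a factor of the word, so they are close to each other, and other chords are
  disjoint or nested. An innermost chord encloses one of the rare exceptional times. Hence there are
  two long intervals of times that are connected by chords (`exists_interval`): the path runs through
  a sequence of blocks of states, and later through the same blocks in the reverse order
  (`IsBlockSequence`).
* Two successive blocks form a cycle. Its length is not `2`, as such a cycle could replace an even
  number of steps between the three visits. The part of the path below a deep chord could be replaced
  by cycles further out if its length was a sum of their lengths; as it is large, the lengths of all
  these cycles are multiples of some `g ≥ 2` (`exists_dvd`).
* The labels of the steps inside a block are read twice, so the word has a nest. Since the lengths of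
  successive blocks add up to at least `3` and are determined modulo `g`, there are fewer shapes of
  nests than a random word would need to have one (`sum_blockPairs_le`).
-/

/-! ### Upper bounds for the automatic complexity -/

theorem automaticComplexity_le {α : Type*} {x : List α} {q : ℕ} (M : NFA α (Fin q))
    (h : IsWitness M x) : automaticComplexity x ≤ q :=
  Nat.sInf_le ⟨M, h⟩

/-- A word that repeats itself with period `k` is read by a directed cycle of `k` states. -/
theorem automaticComplexity_le_of_periodic {α : Type*} (x : List α) (k : ℕ) (hk : 0 < k)
    (f : ℕ → α) (hf : ∀ i : Fin x.length, x.get i = f (i % k)) :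
    automaticComplexity x ≤ k := by
  let M : NFA α (Fin k) :=
    ⟨fun p a => {r | a = f p ∧ r.val = (p.val + 1) % k}, {⟨0, hk⟩},
      {⟨x.length % k, Nat.mod_lt _ hk⟩}⟩
  refine automaticComplexity_le M ⟨⟨_, rfl⟩, fun i => ⟨i % k, Nat.mod_lt _ hk⟩, ⟨?_, ?_, ?_⟩, ?_⟩
  · simp [M]
  · simp [M]
  · intro i
    refine ⟨hf i, ?_⟩
    simp
  · rintro s' w' ⟨h0, -, hstep⟩
    have hs : ∀ j, s' j = ⟨j % k, Nat.mod_lt _ hk⟩ := by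
      intro j
      induction j using Fin.induction with
      | zero =>
        have : s' 0 = ⟨0, hk⟩ := h0
        rw [this]; simp
      | succ i ih =>
        have := (hstep i).2
        rw [ih] at this
        apply Fin.ext
        rw [this]
        simp
    refine ⟨funext hs, funext fun i => ?_⟩
    rw [(hstep i).1, hs, hf]
    simp

/-- A walk of odd length `2 * k - 1` from `0` to `0` whose steps are `±1`, apart from stationary
steps at `k - 1`, needs a stationary step for parity reasons and has no time for any detour. -/
theorem eq_min_of_fold_walk {k : ℕ} (hk : 0 < k) (y : ℕ → ℕ) (h0 : y 0 = 0)
    (h1 : y (2 * k - 1) = 0)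
    (h : ∀ t < 2 * k - 1, y (t + 1) = y t + 1 ∨ y t = y (t + 1) + 1 ∨
      (y t = k - 1 ∧ y (t + 1) = k - 1)) :
    ∀ t ≤ 2 * k - 1, y t = min t (2 * k - 1 - t) := by
  have up : ∀ t ≤ 2 * k - 1, y t ≤ t := by
    intro t
    induction t with
    | zero => omega
    | succ t ih =>
      intro ht
      have := h t (by omega)
      have := ih (by omega)
      by_cases hs : y t = k - 1 ∧ y (t + 1) = k - 1 <;> omega
  have down : ∀ d ≤ 2 * k - 1, y (2 * k - 1 - d) ≤ d := by
    intro d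
    induction d with
    | zero => intro; simp [h1]
    | succ d ih =>
      intro hd
      have h2 := h (2 * k - 1 - (d + 1)) (by omega)
      rw [show 2 * k - 1 - (d + 1) + 1 = 2 * k - 1 - d by omega] at h2
      have := ih (by omega)
      omega
  obtain ⟨t, ht, hy, hy'⟩ : ∃ t < 2 * k - 1, y t = k - 1 ∧ y (t + 1) = k - 1 := by
    by_contra! hc
    have par : ∀ t ≤ 2 * k - 1, y t % 2 = t % 2 := by
      intro t
      induction t with
      | zero => intro; simp [h0]
      | succ t ih =>
        intro ht
        have h2 := h t (by omega)
        have h3 := ih (by omega)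
        have h4 := hc t (by omega)
        omega
    have := par _ le_rfl
    omega
  have htk : t = k - 1 := by
    have h2 := up t (by omega)
    have h3 := down (2 * k - 1 - (t + 1)) (by omega)
    rw [show 2 * k - 1 - (2 * k - 1 - (t + 1)) = t + 1 by omega] at h3
    omega
  subst htk
  have left : ∀ d ≤ k - 1, k - 1 - d ≤ y (k - 1 - d) := by
    intro d
    induction d with
    | zero => intro; simp [hy]
    | succ d ih =>
      intro hd
      have h2 := h (k - 1 - (d + 1)) (by omega)
      rw [show k - 1 - (d + 1) + 1 = k - 1 - d by omega] at h2
      have := ih (by omega)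
      omega
  have right : ∀ d ≤ k - 1, k - 1 - d ≤ y (k - 1 + 1 + d) := by
    intro d
    induction d with
    | zero => intro; simp [hy']
    | succ d ih =>
      intro hd
      have h2 := h (k - 1 + 1 + d) (by omega)
      have := ih (by omega)
      rw [← add_assoc]
      omega
  intro t ht
  have h2 := up t ht
  have h3 := down (2 * k - 1 - t) (by omega)
  rw [show 2 * k - 1 - (2 * k - 1 - t) = t by omega] at h3
  rcases le_or_gt t (k - 1) with h4 | h4
  · have h5 := left (k - 1 - t) (by omega)
    rw [show k - 1 - (k - 1 - t) = t by omega] at h5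
    omega
  · have h5 := right (t - k) (by omega)
    rw [show k - 1 + 1 + (t - k) = t by omega] at h5
    omega

/-- The folded automaton: the word is read along a path `0, …, k - 1`, a loop at `k - 1`, and the
same path backwards, followed, if the length is even, by one edge to an additional state `k`. -/
theorem automaticComplexity_le_half {α : Type*} (x : List α) :
    automaticComplexity x ≤ x.length / 2 + 1 := by
  set n := x.length with hn
  set k := (n + 1) / 2 with hk
  let z : ℕ → ℕ := fun t => if t < 2 * k then min t (2 * k - 1 - t) else k
  have hz : ∀ t, t ≤ n → z t < n / 2 + 1 := by
    intro t ht
    simp only [z]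
    split_ifs <;> omega
  let M : NFA α (Fin (n / 2 + 1)) :=
    ⟨fun p a => {r | ∃ t : Fin n, a = x.get t ∧ p.val = z t ∧ r.val = z (t + 1)}, {0},
      {⟨z n, hz n le_rfl⟩}⟩
  refine automaticComplexity_le M ⟨⟨_, rfl⟩, fun i => ⟨z i, hz i (by omega)⟩, ⟨?_, ?_, ?_⟩, ?_⟩
  · simp [M, z, Fin.ext_iff]
  · simp [M, hn]
  · exact fun i => ⟨i, rfl, rfl, rfl⟩
  rintro s' w' ⟨h0, h1, hstep⟩
  have h0' : (s' 0).val = 0 := by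
    have : s' 0 = 0 := h0
    simp [this]
  have h1' : (s' (Fin.last n)).val = z n := by
    have : s' (Fin.last n) = ⟨z n, hz n le_rfl⟩ := h1
    simp [this]
  -- the states along the walk, as a function on `ℕ`
  let y : ℕ → ℕ := fun t => if h : t < n + 1 then s' ⟨t, h⟩ else 0
  have hy : ∀ i : Fin (n + 1), (s' i).val = y i := fun i => by
    simp only [y]
    rw [dif_pos i.2]
  have hys : ∀ i : Fin n, ∃ t : Fin n, w' i = x.get t ∧ y i = z t ∧ y (i + 1) = z (t + 1) := by
    intro i
    obtain ⟨t, h, h', h''⟩ := hstep i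
    rw [hy] at h' h''
    exact ⟨t, h, h', h''⟩
  rw [hy] at h0' h1'
  simp only [Fin.val_zero, Fin.val_last] at h0' h1'
  have hyz : ∀ t ≤ n, y t = z t := by
    rcases Nat.eq_zero_or_pos k with hk0 | hk0
    · intro t ht
      obtain rfl : t = 0 := by omega
      simp only [h0', z]
      split_ifs <;> omega
    have hmid : ∀ t < 2 * k - 1, y (t + 1) = y t + 1 ∨ y t = y (t + 1) + 1 ∨
        (y t = k - 1 ∧ y (t + 1) = k - 1) := by
      intro t ht
      obtain ⟨u, -, h2, h3⟩ := hys ⟨t, by omega⟩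
      simp only at h2 h3
      have hu := u.2
      -- the state `k` is a dead end, so it is not entered before the end of the walk
      have h4 : t + 1 < n → y (t + 1) < k := by
        intro h
        obtain ⟨v, -, h5, -⟩ := hys ⟨t + 1, h⟩
        have hv := v.2
        simp only [z] at h5
        rw [if_pos (by omega)] at h5
        omega
      simp only [z] at h2 h3 h1'
      rw [if_pos (by omega)] at h2
      by_cases h5 : u.val + 1 < 2 * k
      · rw [if_pos h5] at h3
        omega
      · rw [if_neg h5] at h3
        by_cases h6 : t + 1 < n
        · have := h4 h6
          omega
        · obtain h7 : t + 1 = n := by omega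
          rw [h7] at h3 ⊢
          rw [if_pos (by omega)] at h1'
          omega
    have hend : y (2 * k - 1) = 0 := by
      by_cases h2 : 2 * k = n
      · obtain ⟨u, -, h3, h4⟩ := hys ⟨2 * k - 1, by omega⟩
        have hu := u.2
        simp only [z] at h1' h3 h4
        rw [show 2 * k - 1 + 1 = n by omega, h1', if_neg (by omega)] at h4
        rw [h3]
        split_ifs at h4 ⊢ <;> omega
      · rw [show 2 * k - 1 = n by omega, h1']
        simp only [z]
        split_ifs <;> omega
    have := eq_min_of_fold_walk hk0 y h0' hend hmid
    intro t ht
    by_cases h2 : t < 2 * k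
    · rw [this t (by omega)]
      simp [z, h2]
    · rw [show t = n by omega, h1']
  have hs : s' = fun i => ⟨z i, hz i (by omega)⟩ := by
    funext i
    apply Fin.ext
    rw [hy, hyz _ (by omega)]
  refine ⟨hs, funext fun i => ?_⟩
  obtain ⟨t, h2, h3, h4⟩ := hys i
  rw [h2]
  congr 1
  apply Fin.ext
  rw [hyz _ (by omega)] at h3
  rw [hyz _ (by omega)] at h4
  have := t.2
  have := i.2
  simp only [z] at h3 h4
  split_ifs at h3 h4 <;> omega

/-! ### Walks -/

section Walk

variable {α σ : Type*}

/-- The list `l` of labels and successive states is a walk from `p` to `q` along the transitions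
`step`. -/
def IsWalk (step : σ → α → σ → Prop) : σ → List (α × σ) → σ → Prop
  | p, [], q => p = q
  | p, e :: l, q => step p e.1 e.2 ∧ IsWalk step e.2 l q

variable {step : σ → α → σ → Prop}

theorem isWalk_append {l₁ l₂ : List (α × σ)} {p q : σ} :
    IsWalk step p (l₁ ++ l₂) q ↔ ∃ r, IsWalk step p l₁ r ∧ IsWalk step r l₂ q := by
  induction l₁ generalizing p with
  | nil => simp [IsWalk]
  | cons e l ih => simp [IsWalk, ih, and_assoc]

theorem IsWalk.append {l₁ l₂ : List (α × σ)} {p q r : σ} (h₁ : IsWalk step p l₁ r)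
    (h₂ : IsWalk step r l₂ q) : IsWalk step p (l₁ ++ l₂) q :=
  isWalk_append.2 ⟨r, h₁, h₂⟩

/-- A walk can be cut at any state it visits. -/
theorem IsWalk.exists_split {l : List (α × σ)} {p q r : σ} (h : IsWalk step p l q)
    (hr : r = p ∨ r ∈ l.map Prod.snd) :
    ∃ l₁ l₂, l = l₁ ++ l₂ ∧ IsWalk step p l₁ r ∧ IsWalk step r l₂ q := by
  induction l generalizing p with
  | nil =>
    obtain rfl : r = p := by simpa using hr
    exact ⟨[], [], rfl, rfl, h⟩
  | cons e l ih =>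
    by_cases hrp : r = p
    · subst hrp
      exact ⟨[], e :: l, rfl, rfl, h⟩
    · obtain ⟨l₁, l₂, rfl, h₁, h₂⟩ := ih h.2 (by simpa [hrp] using hr)
      exact ⟨e :: l₁, l₂, rfl, ⟨h.1, h₁⟩, h₂⟩

/-- A path of length `n` is a sequence of states `s` and labels `w` such that no other walk of
length `n` has the same end points. -/
structure IsUniquePath (step : σ → α → σ → Prop) (n : ℕ) (s : ℕ → σ) (w : ℕ → α) : Prop where
  step_mem : ∀ i < n, step (s i) (w i) (s (i + 1))
  unique : ∀ (s' : ℕ → σ) (w' : ℕ → α), s' 0 = s 0 → s' n = s n →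
    (∀ i < n, step (s' i) (w' i) (s' (i + 1))) →
      (∀ i ≤ n, s' i = s i) ∧ ∀ i < n, w' i = w i

/-- The part of the path `(s, w)` between the times `i` and `j`. -/
def pathSegment (s : ℕ → σ) (w : ℕ → α) (i j : ℕ) : List (α × σ) :=
  (List.range' i (j - i)).map fun t => (w t, s (t + 1))

variable {s : ℕ → σ} {w : ℕ → α} {n : ℕ}

@[simp] theorem length_pathSegment (i j : ℕ) : (pathSegment s w i j).length = j - i := by
  simp [pathSegment]

theorem pathSegment_append {i j k : ℕ} (hij : i ≤ j) (hjk : j ≤ k) :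
    pathSegment s w i j ++ pathSegment s w j k = pathSegment s w i k := by
  have : List.range' i (k - i) = List.range' i (j - i) ++ List.range' j (k - j) := by
    have h := @List.range'_append i (j - i) (k - j) 1
    rw [one_mul, show i + (j - i) = j by omega, show j - i + (k - j) = k - i by omega] at h
    exact h.symm
  simp [pathSegment, this]

theorem getElem?_pathSegment {i j t : ℕ} (h : t < j - i) :
    (pathSegment s w i j)[t]? = some (w (i + t), s (i + t + 1)) := by
  simp [pathSegment, h]

theorem mem_pathSegment {i j : ℕ} {e : α × σ} :
    e ∈ pathSegment s w i j ↔ ∃ t, i ≤ t ∧ t < j ∧ e = (w t, s (t + 1)) := by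
  simp only [pathSegment, List.mem_map, List.mem_range'_1]
  constructor
  · rintro ⟨t, ht, rfl⟩
    exact ⟨t, ht.1, by omega, rfl⟩
  · rintro ⟨t, h1, h2, rfl⟩
    exact ⟨t, by omega, rfl⟩

namespace IsUniquePath

theorem isWalk_pathSegment (h : IsUniquePath step n s w) {i j : ℕ} (hij : i ≤ j) (hj : j ≤ n) :
    IsWalk step (s i) (pathSegment s w i j) (s j) := by
  induction j, hij using Nat.le_induction with
  | base => simp [pathSegment, IsWalk]
  | succ j hij ih =>
    rw [← pathSegment_append hij (Nat.le_succ j)]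
    refine (ih (by omega)).append ?_
    simp only [pathSegment, Nat.succ_eq_add_one, Nat.add_sub_cancel_left, List.range'_one,
      List.map_cons, List.map_nil, IsWalk, and_true]
    exact h.step_mem j (by omega)

theorem eq_pathSegment (h : IsUniquePath step n s w) {l : List (α × σ)}
    (hl : IsWalk step (s 0) l (s n)) (hn : l.length = n) : l = pathSegment s w 0 n := by
  -- the states and labels of `l` by index
  let s' : ℕ → σ := fun i => Nat.casesOn i (s 0) fun j => (l[j]?.map Prod.snd).getD (s 0)
  let w' : ℕ → α := fun i => (l[i]?.map Prod.fst).getD (w i)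
  have key : ∀ (l : List (α × σ)) (p q : σ), IsWalk step p l q → ∀ (d : σ) (w : ℕ → α),
      (∀ i < l.length, step (Nat.casesOn i p fun j => (l[j]?.map Prod.snd).getD d)
        ((l[i]?.map Prod.fst).getD (w i)) ((l[i]?.map Prod.snd).getD d)) ∧
      (Nat.casesOn l.length p fun j => (l[j]?.map Prod.snd).getD d : σ) = q := by
    intro l
    induction l with
    | nil =>
      intro p q hl d w
      exact ⟨by simp, hl⟩
    | cons e l ih =>
      intro p q hl d w
      obtain ⟨h1, h2⟩ := ih e.2 q hl.2 d (fun i => w (i + 1))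
      constructor
      · intro i hi
        cases i with
        | zero => simpa using hl.1
        | succ i =>
          have := h1 i (by simpa using hi)
          cases i <;> simpa using this
      · cases l <;> simpa using h2
  obtain ⟨h1, h2⟩ := key l _ _ hl (s 0) w
  obtain ⟨h3, h4⟩ := h.unique s' w' rfl (by rw [← h2, hn])
    (fun i hi => h1 i (by omega))
  apply List.ext_getElem?
  intro i
  by_cases hi : i < n
  · rw [getElem?_pathSegment (by omega)]
    have h5 := h3 (i + 1) (by omega)
    have h6 := h4 i hi
    simp only [s', w', List.getElem?_eq_getElem (hn ▸ hi : i < l.length), Option.map_some,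
      Option.getD_some] at h5 h6
    rw [List.getElem?_eq_getElem (hn ▸ hi : i < l.length), zero_add, ← h5, ← h6]
  · rw [List.getElem?_eq_none (by omega), List.getElem?_eq_none (by simp; omega)]

/-- Exchanging two stretches of the path with the same end points gives the same path. -/
theorem pathSegment_swap (h : IsUniquePath step n s w) {j k j' k' : ℕ} (h1 : j ≤ k) (h2 : k ≤ j')
    (h3 : j' ≤ k') (h4 : k' ≤ n) (hj : s j = s j') (hk : s k = s k') :
    pathSegment s w j' k' ++ (pathSegment s w k j' ++ pathSegment s w j k) =
      pathSegment s w j k ++ (pathSegment s w k j' ++ pathSegment s w j' k') := by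
  have w1 := h.isWalk_pathSegment (Nat.zero_le j) (by omega)
  have w2 := h.isWalk_pathSegment h3 h4
  have w3 := h.isWalk_pathSegment h2 (by omega)
  have w4 := h.isWalk_pathSegment h1 (by omega)
  have w5 := h.isWalk_pathSegment h4 le_rfl
  rw [← hj, ← hk] at w2
  rw [← hj] at w3
  rw [← hk] at w5
  have := h.eq_pathSegment (w1.append ((w2.append (w3.append w4)).append w5))
    (by simp; omega)
  rw [← pathSegment_append (Nat.zero_le j) (by omega : j ≤ n),
    ← pathSegment_append (by omega : j ≤ k') (by omega : k' ≤ n),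
    ← pathSegment_append (by omega : j ≤ k) (by omega : k ≤ k'), ← pathSegment_append h2 h3] at this
  simp only [List.append_assoc, List.append_cancel_left_eq] at this
  apply List.append_cancel_right (bs := pathSegment s w k' n)
  simpa only [List.append_assoc] using this

/-- Closed walks whose lengths add up to `j' - j` cannot replace the closed stretch `[j, j']` of the
path, if they are based at states that remain and avoid a state `b` of that stretch: the state `b`
would be visited less often. -/
theorem sub_notMem_closure (h : IsUniquePath step n s w) {j j' t : ℕ} (hj' : j' ≤ n)
    (hs : s j = s j') (hjt : j < t) (htj' : t ≤ j') (V : Set ℕ)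
    (hV : ∀ v ∈ V, ∃ τ ≤ n, (τ ≤ j ∨ j' ≤ τ) ∧ ∃ l, IsWalk step (s τ) l (s τ) ∧ l.length = v ∧
      s t ∉ l.map Prod.snd) : j' - j ∉ AddSubmonoid.closure V := by
  classical
  intro hmem
  have key : ∀ m ∈ AddSubmonoid.closure V, ∃ l, IsWalk step (s 0) l (s n) ∧
      l.length = n - (j' - j) + m ∧
      (l.map Prod.snd).count (s t) =
        ((pathSegment s w 0 j ++ pathSegment s w j' n).map Prod.snd).count (s t) ∧
      ∀ τ ≤ n, (τ ≤ j ∨ j' ≤ τ) → s τ = s 0 ∨ s τ ∈ l.map Prod.snd := by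
    intro m hm
    induction hm using AddSubmonoid.closure_induction_left with
    | zero =>
      refine ⟨pathSegment s w 0 j ++ pathSegment s w j' n, ?_, ?_, rfl, ?_⟩
      · refine (h.isWalk_pathSegment (Nat.zero_le j) (by omega)).append ?_
        rw [hs]
        exact h.isWalk_pathSegment hj' le_rfl
      · simp
        omega
      · intro τ hτ hτ'
        have main : ∀ u, (u < j ∨ j' ≤ u) → u < n →
            s (u + 1) ∈ (pathSegment s w 0 j ++ pathSegment s w j' n).map Prod.snd := by
          intro u hu hun
          rw [List.mem_map]
          refine ⟨(w u, s (u + 1)), ?_, rfl⟩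
          rw [List.mem_append, mem_pathSegment, mem_pathSegment]
          rcases hu with hu | hu
          · exact Or.inl ⟨u, by omega, hu, rfl⟩
          · exact Or.inr ⟨u, hu, hun, rfl⟩
        rcases Nat.eq_zero_or_pos τ with rfl | hτ0
        · exact Or.inl rfl
        · by_cases hτj' : τ = j'
          · rw [hτj', ← hs]
            rcases Nat.eq_zero_or_pos j with rfl | hj0
            · exact Or.inl rfl
            · right
              have := main (j - 1) (by omega) (by omega)
              rwa [show j - 1 + 1 = j by omega] at this
          · right
            have := main (τ - 1) (by omega) (by omega)
            rwa [show τ - 1 + 1 = τ by omega] at this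
    | add_left v hv m hm ih =>
      obtain ⟨l, hl, hlen, hcount, hvis⟩ := ih
      obtain ⟨τ, hτ, hτ', c, hc, hcv, hcb⟩ := hV v hv
      obtain ⟨l₁, l₂, rfl, h1, h2⟩ := hl.exists_split (hvis τ hτ hτ')
      refine ⟨l₁ ++ (c ++ l₂), h1.append (hc.append h2), ?_, ?_, ?_⟩
      · simp only [List.length_append] at hlen ⊢
        omega
      · rw [← hcount]
        simp [List.count_eq_zero_of_not_mem hcb]
      · intro τ' h3 h4
        rcases hvis τ' h3 h4 with h5 | h5
        · exact Or.inl h5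
        · right
          simp only [List.map_append, List.mem_append] at h5 ⊢
          tauto
  obtain ⟨l, hl, hlen, hcount, -⟩ := key _ hmem
  have := h.eq_pathSegment hl (by omega)
  rw [this, ← pathSegment_append (Nat.zero_le j) (by omega : j ≤ n),
    ← pathSegment_append (by omega : j ≤ j') hj'] at hcount
  have hpos : 0 < ((pathSegment s w j j').map Prod.snd).count (s t) := by
    rw [List.count_pos_iff, List.mem_map]
    refine ⟨(w (t - 1), s (t - 1 + 1)), mem_pathSegment.2 ⟨t - 1, by omega, by omega, rfl⟩, ?_⟩
    rw [show t - 1 + 1 = t by omega]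
  simp only [List.map_append, List.count_append] at hcount
  omega

end IsUniquePath

end Walk

/-! ### Repeated states of a unique path -/

/-- Distinct positions of the word `w` of length `n` start distinct factors of length `ℓ`. -/
def HasDistinctFactors {α : Type*} (ℓ n : ℕ) (w : ℕ → α) : Prop :=
  ∀ i j, i < j → j + ℓ ≤ n → ∃ t < ℓ, w (i + t) ≠ w (j + t)

theorem HasDistinctFactors.lt {α : Type*} {ℓ n : ℕ} {w : ℕ → α} (h : HasDistinctFactors ℓ n w)
    {i j d : ℕ} (hij : i < j) (hd : j + d ≤ n) (hw : ∀ t < d, w (i + t) = w (j + t)) : d < ℓ := by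
  by_contra! hc
  obtain ⟨t, ht, hne⟩ := h i j hij (by omega)
  exact hne (hw t (by omega))

section Chord

variable {α σ : Type*}

/-- The times `i < j` are the only two visits to a state, and they are at distance at least
`2 * ℓ`. -/
def IsChord (s : ℕ → σ) (n ℓ i j : ℕ) : Prop :=
  i < j ∧ j ≤ n ∧ s i = s j ∧ i + 2 * ℓ ≤ j ∧ ∀ t ≤ n, s t = s i → t = i ∨ t = j

/-- The time `t` is an end point of a chord. -/
def IsGoodTime (s : ℕ → σ) (n ℓ t : ℕ) : Prop :=
  ∃ u, IsChord s n ℓ t u ∨ IsChord s n ℓ u t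

theorem IsGoodTime.le {s : ℕ → σ} {n ℓ t : ℕ} (h : IsGoodTime s n ℓ t) : t ≤ n := by
  obtain ⟨u, h | h⟩ := h
  · exact h.1.le.trans h.2.1
  · exact h.2.1

/-- Being an end point of a chord depends on the state only. -/
theorem IsGoodTime.congr {s : ℕ → σ} {n ℓ t t' : ℕ} (h : IsGoodTime s n ℓ t) (ht' : t' ≤ n)
    (hs : s t' = s t) : IsGoodTime s n ℓ t' := by
  obtain ⟨u, h | h⟩ := h
  · rcases h.2.2.2.2 t' ht' hs with rfl | rfl
    · exact ⟨u, Or.inl h⟩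
    · exact ⟨t, Or.inr h⟩
  · rcases h.2.2.2.2 t' ht' (hs.trans h.2.2.1.symm) with rfl | rfl
    · exact ⟨t, Or.inl h⟩
    · exact ⟨u, Or.inr h⟩

variable {step : σ → α → σ → Prop} {s : ℕ → σ} {w : ℕ → α} {n ℓ : ℕ}

namespace IsUniquePath

/-- The word read between three visits to the same state is periodic. -/
theorem sub_lt_of_three_visits (h : IsUniquePath step n s w) (hU : HasDistinctFactors ℓ n w)
    {t₁ t₂ t₃ : ℕ} (h12 : t₁ < t₂) (h23 : t₂ < t₃) (h3 : t₃ ≤ n) (e12 : s t₁ = s t₂)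
    (e23 : s t₂ = s t₃) : t₂ - t₁ < ℓ ∧ t₃ - t₂ < ℓ := by
  have hsw := h.pathSegment_swap h12.le le_rfl h23.le h3 e12 e23
  rw [pathSegment_append le_rfl h23.le, pathSegment_append h12.le h23.le] at hsw
  have hnil : pathSegment s w t₂ t₂ = [] := by simp [pathSegment]
  rw [hnil, List.nil_append] at hsw
  constructor
  · refine hU.lt (i := t₁) (j := t₁ + (t₃ - t₂)) (by omega) (by omega) fun t ht => ?_
    have := congrArg (fun l => l[t₃ - t₂ + t]?) hsw
    rw [List.getElem?_append_right (by simp), length_pathSegment, Nat.add_sub_cancel_left,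
      getElem?_pathSegment ht, getElem?_pathSegment (by omega)] at this
    simp only [Option.some.injEq, Prod.mk.injEq] at this
    rw [this.1, add_assoc]
  · refine hU.lt (i := t₁) (j := t₂) h12 (by omega) fun t ht => ?_
    have := congrArg (fun l => l[t]?) hsw
    rw [List.getElem?_append_left (by simpa), getElem?_pathSegment (by omega),
      getElem?_pathSegment (by omega)] at this
    simp only [Option.some.injEq, Prod.mk.injEq] at this
    exact this.1.symm

/-- If the visits to two states interlace, the path between the first visits is repeated between
the second visits. -/
theorem eq_of_crossing (h : IsUniquePath step n s w) (hU : HasDistinctFactors ℓ n w)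
    {j k j' k' : ℕ} (h1 : j < k) (h2 : k < j') (h3 : j' < k') (h4 : k' ≤ n) (hj : s j = s j')
    (hk : s k = s k') (hk2 : ∀ t ≤ n, s t = s k → t = k ∨ t = k') :
    k' - j' = k - j ∧ k - j < ℓ ∧ (∀ i ≤ k - j, s (j + i) = s (j' + i)) ∧
      ∀ i < k - j, w (j + i) = w (j' + i) := by
  have hsw := h.pathSegment_swap h1.le h2.le h3.le h4 hj hk
  rw [pathSegment_append h2.le h3.le, pathSegment_append h1.le (by omega)] at hsw
  have key : ∀ i < k' - j', w (j + i) = w (j' + i) ∧ s (j + i + 1) = s (j' + i + 1) := by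
    intro i hi
    have := congrArg (fun l => l[i]?) hsw
    rw [List.getElem?_append_left (by simpa), getElem?_pathSegment (by omega),
      getElem?_pathSegment (by omega)] at this
    simp only [Option.some.injEq, Prod.mk.injEq] at this
    exact ⟨this.1.symm, this.2.symm⟩
  have hlt : k' - j' < ℓ := hU.lt (by omega) (by omega) fun i hi => (key i hi).1
  have heq : k' - j' = k - j := by
    have h5 := (key (k' - j' - 1) (by omega)).2
    rw [show j' + (k' - j' - 1) + 1 = k' by omega, ← hk] at h5
    rcases hk2 _ (by omega) h5 with h6 | h6 <;> omega
  refine ⟨heq, heq ▸ hlt, fun i hi => ?_, fun i hi => (key i (by omega)).1⟩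
  cases i with
  | zero => exact hj
  | succ i => exact (key i (by omega)).2

/-- Every chord encloses the time of a state which has no chord: an innermost chord has no room for
the crossings that it would otherwise be involved in. -/
theorem exists_not_isGoodTime (h : IsUniquePath step n s w) (hU : HasDistinctFactors ℓ n w)
    (hℓ : 0 < ℓ) {i j : ℕ} (hc : IsChord s n ℓ i j) :
    ∃ t, i < t ∧ t < j ∧ ¬ IsGoodTime s n ℓ t := by
  induction hd : j - i using Nat.strong_induction_on generalizing i j with
  | _ d ih =>
    by_contra! hg
    have hinner : ∀ i' j', IsChord s n ℓ i' j' → i < i' → j' < j → False := by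
      intro i' j' hc' h1 h2
      obtain ⟨t, h3, h4, h5⟩ := ih (j' - i') (by have := hc'.1; omega) hc' rfl
      exact h5 (hg t (by omega) (by omega))
    obtain ⟨hij, hjn, hs, hlen, huniq⟩ := hc
    obtain ⟨u, hu | hu⟩ := hg (i + ℓ) (by omega) (by omega)
    · have huj : j < u := by
        by_contra! hle
        rcases hle.lt_or_eq with hlt | rfl
        · exact hinner _ _ hu (by omega) hlt
        · have := huniq (i + ℓ) (by omega) (hu.2.2.1.trans hs.symm)
          omega
      have := h.eq_of_crossing hU (by omega : i < i + ℓ) (by omega) huj hu.2.1 hs hu.2.2.1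
        hu.2.2.2.2
      omega
    · have hui : u < i := by
        by_contra! hle
        rcases hle.lt_or_eq with hlt | rfl
        · exact hinner _ _ hu hlt (by omega)
        · have := huniq (i + ℓ) (by omega) hu.2.2.1.symm
          omega
      have := h.eq_of_crossing hU hui (by omega : i < i + ℓ) (by omega) hjn hu.2.2.1 hs huniq
      omega

/-- The returns after a given short time `u` are concentrated in one place: otherwise one such
closed walk could be replaced by another one. -/
theorem le_of_short_return (h : IsUniquePath step n s w) (hU : HasDistinctFactors ℓ n w)
    {t τ u : ℕ} (hu : 0 < u) (huℓ : u < 2 * ℓ) (htτ : t ≤ τ) (hτ : τ + u ≤ n)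
    (hst : s t = s (t + u)) (hsτ : s τ = s (τ + u)) : τ ≤ t + 2 * ℓ := by
  by_contra! hlt
  refine h.sub_notMem_closure (j := t) (j' := t + u) (t := t + u) (by omega) hst (by omega) le_rfl
    {u} ?_ ?_
  · intro v hv
    rw [Set.mem_singleton_iff.1 hv]
    have hwalk := h.isWalk_pathSegment (Nat.le_add_right τ u) hτ
    rw [← hsτ] at hwalk
    refine ⟨τ, by omega, Or.inr (by omega), _, hwalk, by simp, fun hmem => ?_⟩
    obtain ⟨e, he, hes⟩ := List.mem_map.1 hmem
    obtain ⟨y, hy1, hy2, rfl⟩ := mem_pathSegment.1 he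
    have := h.sub_lt_of_three_visits hU (t₁ := t) (t₂ := t + u) (t₃ := y + 1) (by omega)
      (by omega) (by omega) hst hes.symm
    omega
  · rw [Nat.add_sub_cancel_left]
    exact AddSubmonoid.subset_closure rfl

open Classical in
/-- The times at which the path visits a state that it also visits less than `2 * ℓ` steps earlier
or later. -/
noncomputable def _root_.shortTimes (s : ℕ → σ) (n ℓ : ℕ) : Finset ℕ :=
  (Finset.range (n + 1)).filter fun t =>
    ∃ t' ≤ n, t' ≠ t ∧ s t' = s t ∧ t < t' + 2 * ℓ ∧ t' < t + 2 * ℓ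

theorem card_shortTimes_le (h : IsUniquePath step n s w) (hU : HasDistinctFactors ℓ n w) :
    (shortTimes s n ℓ).card ≤ 2 * ℓ * (2 * (2 * ℓ + 1)) := by
  classical
  let G : ℕ → Finset ℕ := fun u =>
    (Finset.range (n + 1)).filter fun t => 0 < u ∧ t + u ≤ n ∧ s t = s (t + u)
  have hG : ∀ u < 2 * ℓ, (G u).card ≤ 2 * ℓ + 1 := by
    intro u hu
    rcases (G u).eq_empty_or_nonempty with he | hne
    · simp [he]
    · have hsub : G u ⊆ Finset.Icc ((G u).min' hne) ((G u).min' hne + 2 * ℓ) := by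
        intro τ hτ
        have h1 := (G u).min'_le τ hτ
        have h2 := (G u).min'_mem hne
        simp only [G, Finset.mem_filter] at h2 hτ
        rw [Finset.mem_Icc]
        exact ⟨h1, h.le_of_short_return hU hτ.2.1 hu h1 hτ.2.2.1 h2.2.2.2 hτ.2.2.2⟩
      have := Finset.card_le_card hsub
      rw [Nat.card_Icc] at this
      omega
  have hsub : shortTimes s n ℓ ⊆
      (Finset.range (2 * ℓ)).biUnion fun u => G u ∪ (G u).image (· + u) := by
    intro t ht
    simp only [shortTimes, Finset.mem_filter, Finset.mem_range] at ht
    obtain ⟨htn, t', ht', hne, hs, h1, h2⟩ := ht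
    simp only [Finset.mem_biUnion, Finset.mem_range, Finset.mem_union, Finset.mem_image, G,
      Finset.mem_filter]
    rcases lt_or_gt_of_ne hne with hlt | hlt
    · refine ⟨t - t', by omega, Or.inr ⟨t', ⟨by omega, by omega, by omega, ?_⟩, by omega⟩⟩
      rw [hs, show t' + (t - t') = t by omega]
    · refine ⟨t' - t, by omega, Or.inl ⟨by omega, by omega, by omega, ?_⟩⟩
      rw [← hs, show t + (t' - t) = t' by omega]
  refine (Finset.card_le_card hsub).trans ((Finset.card_biUnion_le_card_mul _ _
    (2 * (2 * ℓ + 1)) ?_).trans (by simp))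
  intro u hu
  have h1 := hG u (Finset.mem_range.1 hu)
  have h2 := Finset.card_union_le (G u) ((G u).image (· + u))
  have h3 := Finset.card_image_le (s := G u) (f := (· + u))
  omega

theorem _root_.Finset.exists_lt_lt_of_two_lt_card {A : Finset ℕ} (h : 2 < A.card) :
    ∃ a ∈ A, ∃ b ∈ A, ∃ c ∈ A, a < b ∧ b < c := by
  obtain ⟨a, b, c, ha, hb, hc, hab, hac, hbc⟩ := Finset.two_lt_card_iff.1 h
  rcases lt_or_gt_of_ne hab with h1 | h1 <;> rcases lt_or_gt_of_ne hac with h2 | h2 <;>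
    rcases lt_or_gt_of_ne hbc with h3 | h3 <;>
    first
    | omega
    | exact ⟨a, ha, b, hb, c, hc, h1, h3⟩
    | exact ⟨a, ha, c, hc, b, hb, h2, h3⟩
    | exact ⟨b, hb, a, ha, c, hc, h1, h2⟩
    | exact ⟨b, hb, c, hc, a, ha, h3, h2⟩
    | exact ⟨c, hc, a, ha, b, hb, h2, h1⟩
    | exact ⟨c, hc, b, hb, a, ha, h3, h1⟩

theorem _root_.exists_three_visits [Fintype σ] (hq : 2 * Fintype.card σ ≤ n) (s : ℕ → σ) :
    ∃ t₁ t₂ t₃, t₁ < t₂ ∧ t₂ < t₃ ∧ t₃ ≤ n ∧ s t₁ = s t₂ ∧ s t₂ = s t₃ := by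
  classical
  obtain ⟨b, -, hb⟩ := Finset.exists_lt_card_fiber_of_mul_lt_card_of_maps_to
    (s := Finset.range (n + 1)) (t := Finset.univ) (f := s) (n := 2) (by simp)
    (by rw [Finset.card_univ, Finset.card_range]; omega)
  obtain ⟨t₁, h1, t₂, h2, t₃, h3, h12, h23⟩ := Finset.exists_lt_lt_of_two_lt_card hb
  simp only [Finset.mem_filter, Finset.mem_range] at h1 h2 h3
  exact ⟨t₁, t₂, t₃, h12, h23, by omega, h1.2.trans h2.2.symm, h2.2.trans h3.2.symm⟩

open Classical in
/-- The times of the states without a chord. -/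
noncomputable def _root_.badTimes (s : ℕ → σ) (n ℓ : ℕ) : Finset ℕ :=
  (Finset.range (n + 1)).filter fun t => ¬ IsGoodTime s n ℓ t

/-- If there are few states, almost all times belong to chords: there are few visits to states which
are visited more than twice, hence even fewer states visited only once. -/
theorem card_badTimes_le [Fintype σ] (h : IsUniquePath step n s w)
    (hU : HasDistinctFactors ℓ n w) (hq : 2 * Fintype.card σ ≤ n) :
    (badTimes s n ℓ).card ≤ 2 * (2 * ℓ * (2 * (2 * ℓ + 1))) := by
  classical
  let F : σ → Finset ℕ := fun b => (Finset.range (n + 1)).filter fun t => s t = b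
  let single : Finset ℕ := (Finset.range (n + 1)).filter fun t => (F (s t)).card = 1
  let heavy : Finset ℕ := (Finset.range (n + 1)).filter fun t => 2 < (F (s t)).card
  have hmemF : ∀ t b, t ∈ F b ↔ t ≤ n ∧ s t = b := by
    intro t b
    simp only [F, Finset.mem_filter, Finset.mem_range, Nat.lt_succ_iff]
  -- two visits to a state that is visited more than twice are close to each other
  have hclose : ∀ t t', t ≤ n → t' ≤ n → t < t' → s t = s t' → 2 < (F (s t)).card →
      t' < t + 2 * ℓ := by
    intro t t' ht ht' hlt hs hF
    obtain ⟨u, hu, hut, hut'⟩ : ∃ u ∈ F (s t), u ≠ t ∧ u ≠ t' := by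
      by_contra! hc
      have : F (s t) ⊆ {t, t'} := by
        intro u hu
        have := hc u hu
        simp only [Finset.mem_insert, Finset.mem_singleton]
        tauto
      have := (Finset.card_le_card this).trans Finset.card_le_two
      omega
    obtain ⟨hun, hus⟩ := (hmemF _ _).1 hu
    rcases lt_or_gt_of_ne hut with h1 | h1
    · have := h.sub_lt_of_three_visits hU h1 hlt ht' hus hs
      omega
    · rcases lt_or_gt_of_ne hut' with h2 | h2
      · have := h.sub_lt_of_three_visits hU h1 h2 ht' hus.symm (hus.trans hs)
        omega
      · have := h.sub_lt_of_three_visits hU hlt h2 hun hs (hs.symm.trans hus.symm)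
        omega
  have hheavy : heavy ⊆ shortTimes s n ℓ := by
    intro t ht
    simp only [heavy, Finset.mem_filter, Finset.mem_range] at ht
    obtain ⟨u, hu, hut⟩ : ∃ u ∈ F (s t), u ≠ t :=
      Finset.exists_mem_ne (by omega) t
    obtain ⟨hun, hus⟩ := (hmemF _ _).1 hu
    simp only [shortTimes, Finset.mem_filter, Finset.mem_range]
    refine ⟨ht.1, u, hun, hut, hus, ?_⟩
    rcases lt_or_gt_of_ne hut with h1 | h1
    · have := hclose u t hun (by omega) h1 hus (hus ▸ ht.2)
      omega
    · have := hclose t u (by omega) hun h1 hus.symm ht.2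
      omega
  have hsingle : single.card ≤ heavy.card := by
    have e1 : n + 1 = ∑ b : σ, (F b).card := by
      have := Finset.card_eq_sum_card_fiberwise (s := Finset.range (n + 1)) (t := Finset.univ)
        (f := s) (by simp)
      simpa [F] using this
    have e2 : single.card = ∑ b : σ, (single.filter fun t => s t = b).card :=
      Finset.card_eq_sum_card_fiberwise (by simp)
    have e3 : heavy.card = ∑ b : σ, (heavy.filter fun t => s t = b).card :=
      Finset.card_eq_sum_card_fiberwise (by simp)
    have hb : ∀ b : σ, (F b).card + (single.filter fun t => s t = b).card ≤
        2 + (heavy.filter fun t => s t = b).card := by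
      intro b
      have s1 : (single.filter fun t => s t = b).card ≤ (F b).card := by
        apply Finset.card_le_card
        intro t ht
        simp only [single, Finset.mem_filter, Finset.mem_range] at ht
        exact (hmemF _ _).2 ⟨by omega, ht.2⟩
      have s2 : (F b).card ≠ 1 → (single.filter fun t => s t = b).card = 0 := by
        intro hne
        rw [Finset.card_eq_zero, Finset.eq_empty_iff_forall_notMem]
        intro t ht
        simp only [single, Finset.mem_filter, Finset.mem_range] at ht
        exact hne (ht.2 ▸ ht.1.2)
      have s3 : 2 < (F b).card → (F b).card ≤ (heavy.filter fun t => s t = b).card := by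
        intro hlt
        apply Finset.card_le_card
        intro t ht
        obtain ⟨h1, h2⟩ := (hmemF _ _).1 ht
        simp only [heavy, Finset.mem_filter, Finset.mem_range]
        exact ⟨⟨by omega, h2 ▸ hlt⟩, h2⟩
      omega
    have := Finset.sum_le_sum fun b (_ : b ∈ Finset.univ) => hb b
    rw [Finset.sum_add_distrib, Finset.sum_add_distrib, ← e1, ← e2, ← e3] at this
    simp only [Finset.sum_const, Finset.card_univ, smul_eq_mul] at this
    omega
  have hbad : badTimes s n ℓ ⊆ single ∪ shortTimes s n ℓ := by
    intro t ht
    simp only [badTimes, Finset.mem_filter, Finset.mem_range] at ht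
    by_contra hc
    simp only [Finset.mem_union, not_or] at hc
    obtain ⟨hc1, hc2⟩ := hc
    have hc3 : t ∉ heavy := fun hh => hc2 (hheavy hh)
    simp only [single, heavy, Finset.mem_filter, Finset.mem_range, not_and] at hc1 hc3
    have hpos : 0 < (F (s t)).card :=
      Finset.card_pos.2 ⟨t, (hmemF _ _).2 ⟨by omega, rfl⟩⟩
    have htwo : (F (s t)).card = 2 := by
      have := hc1 ht.1
      have := hc3 ht.1
      omega
    obtain ⟨u, hu, hut⟩ : ∃ u ∈ F (s t), u ≠ t := Finset.exists_mem_ne (by omega) t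
    obtain ⟨hun, hus⟩ := (hmemF _ _).1 hu
    have hFeq : F (s t) = {t, u} := by
      symm
      apply Finset.eq_of_subset_of_card_le
      · intro v hv
        simp only [Finset.mem_insert, Finset.mem_singleton] at hv
        rcases hv with rfl | rfl
        · exact (hmemF _ _).2 ⟨by omega, rfl⟩
        · exact hu
      · rw [htwo, Finset.card_pair hut.symm]
    have hall : ∀ v ≤ n, s v = s t → v = t ∨ v = u := by
      intro v hv hvs
      have : v ∈ F (s t) := (hmemF _ _).2 ⟨hv, hvs⟩
      rw [hFeq] at this
      simpa using this
    have hfar : t + 2 * ℓ ≤ u ∨ u + 2 * ℓ ≤ t := by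
      by_contra! hc
      apply hc2
      simp only [shortTimes, Finset.mem_filter, Finset.mem_range]
      exact ⟨ht.1, u, hun, hut, hus, by omega, by omega⟩
    apply ht.2
    rcases hfar with hf | hf
    · exact ⟨u, Or.inl ⟨by omega, hun, hus.symm, hf, hall⟩⟩
    · refine ⟨u, Or.inr ⟨by omega, by omega, hus, hf, fun v hv hvs => ?_⟩⟩
      exact (hall v hv (hvs.trans hus)).symm
  have h1 := Finset.card_le_card hbad
  have h2 := Finset.card_union_le single (shortTimes s n ℓ)
  have h3 := Finset.card_le_card hheavy
  have h4 := h.card_shortTimes_le hU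
  omega

end IsUniquePath

end Chord

/-! ### Chords between windows -/

section Window

variable {α σ : Type*} {step : σ → α → σ → Prop} {s : ℕ → σ} {w : ℕ → α} {n ℓ : ℕ}

open Classical in
/-- The other visit to the state visited at a time which belongs to a chord. -/
noncomputable def partner (s : ℕ → σ) (n ℓ t : ℕ) : ℕ :=
  if h : IsGoodTime s n ℓ t then h.choose else t

theorem IsGoodTime.isChord_partner {t : ℕ} (h : IsGoodTime s n ℓ t) :
    IsChord s n ℓ t (partner s n ℓ t) ∨ IsChord s n ℓ (partner s n ℓ t) t := by
  rw [partner, dif_pos h]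
  exact h.choose_spec

theorem IsGoodTime.partner_le {t : ℕ} (h : IsGoodTime s n ℓ t) : partner s n ℓ t ≤ n := by
  rcases h.isChord_partner with hc | hc
  · exact hc.2.1
  · exact hc.1.le.trans hc.2.1

theorem IsGoodTime.apply_partner {t : ℕ} (h : IsGoodTime s n ℓ t) :
    s (partner s n ℓ t) = s t := by
  rcases h.isChord_partner with hc | hc
  · exact hc.2.2.1.symm
  · exact hc.2.2.1

theorem IsGoodTime.partner_ne {t : ℕ} (h : IsGoodTime s n ℓ t) : partner s n ℓ t ≠ t := by
  rcases h.isChord_partner with hc | hc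
  · exact hc.1.ne'
  · exact hc.1.ne

theorem IsGoodTime.isGoodTime_partner {t : ℕ} (h : IsGoodTime s n ℓ t) :
    IsGoodTime s n ℓ (partner s n ℓ t) :=
  h.congr h.partner_le h.apply_partner

theorem IsGoodTime.eq_partner {t v : ℕ} (h : IsGoodTime s n ℓ t) (hv : v ≤ n) (hs : s v = s t)
    (hne : v ≠ t) : v = partner s n ℓ t := by
  rcases h.isChord_partner with hc | hc
  · exact (hc.2.2.2.2 v hv hs).resolve_left hne
  · exact (hc.2.2.2.2 v hv (hs.trans hc.2.2.1.symm)).resolve_right hne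

theorem IsGoodTime.partner_partner {t : ℕ} (h : IsGoodTime s n ℓ t) :
    partner s n ℓ (partner s n ℓ t) = t :=
  (h.isGoodTime_partner.eq_partner h.le h.apply_partner.symm h.partner_ne.symm).symm

theorem IsGoodTime.isChord_of_lt {t : ℕ} (h : IsGoodTime s n ℓ t)
    (hlt : t < partner s n ℓ t) : IsChord s n ℓ t (partner s n ℓ t) :=
  h.isChord_partner.resolve_right fun hc => hc.1.not_gt hlt

theorem IsGoodTime.isChord_of_gt {t : ℕ} (h : IsGoodTime s n ℓ t)
    (hlt : partner s n ℓ t < t) : IsChord s n ℓ (partner s n ℓ t) t :=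
  h.isChord_partner.resolve_left fun hc => hc.1.not_gt hlt

/-- The number of times `≤ t` without a chord. It is constant on each window between two of
them. -/
noncomputable def windowIndex (s : ℕ → σ) (n ℓ t : ℕ) : ℕ :=
  ((badTimes s n ℓ).filter (· ≤ t)).card

theorem windowIndex_mono {t t' : ℕ} (h : t ≤ t') :
    windowIndex s n ℓ t ≤ windowIndex s n ℓ t' :=
  Finset.card_le_card fun u hu => by
    simp only [Finset.mem_filter] at hu ⊢
    exact ⟨hu.1, hu.2.trans h⟩

theorem windowIndex_eq_iff {t t' : ℕ} (h : t ≤ t') (h' : t' ≤ n) :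
    windowIndex s n ℓ t = windowIndex s n ℓ t' ↔
      ∀ u, t < u → u ≤ t' → IsGoodTime s n ℓ u := by
  have hsub : (badTimes s n ℓ).filter (· ≤ t) ⊆ (badTimes s n ℓ).filter (· ≤ t') := by
    intro u hu
    simp only [Finset.mem_filter] at hu ⊢
    exact ⟨hu.1, hu.2.trans h⟩
  constructor
  · intro heq u hu hu'
    have := Finset.eq_of_subset_of_card_le hsub heq.ge
    by_contra hbad
    have hmem : u ∈ (badTimes s n ℓ).filter (· ≤ t') := by
      simp only [badTimes, Finset.mem_filter, Finset.mem_range]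
      exact ⟨⟨by omega, hbad⟩, hu'⟩
    rw [← this, Finset.mem_filter] at hmem
    omega
  · intro hgood
    refine congrArg Finset.card (hsub.antisymm fun u hu => ?_)
    simp only [badTimes, Finset.mem_filter, Finset.mem_range] at hu ⊢
    refine ⟨hu.1, ?_⟩
    by_contra hlt
    exact hu.1.2 (hgood u (by omega) hu.2)

namespace IsUniquePath

theorem windowIndex_partner_ne (h : IsUniquePath step n s w) (hU : HasDistinctFactors ℓ n w)
    (hℓ : 0 < ℓ) {t : ℕ} (ht : IsGoodTime s n ℓ t) :
    windowIndex s n ℓ t ≠ windowIndex s n ℓ (partner s n ℓ t) := by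
  intro heq
  rcases ht.isChord_partner with hc | hc
  · obtain ⟨u, h1, h2, h3⟩ := h.exists_not_isGoodTime hU hℓ hc
    exact h3 ((windowIndex_eq_iff hc.1.le hc.2.1).1 heq u h1 h2.le)
  · obtain ⟨u, h1, h2, h3⟩ := h.exists_not_isGoodTime hU hℓ hc
    exact h3 ((windowIndex_eq_iff hc.1.le hc.2.1).1 heq.symm u h1 h2.le)

/-- Crossing chords start in the same window if and only if they end in the same window. -/
theorem windowIndex_eq_iff_of_crossing (h : IsUniquePath step n s w)
    (hU : HasDistinctFactors ℓ n w) {a a' b b' : ℕ} (ha : IsChord s n ℓ a a')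
    (hb : IsChord s n ℓ b b') (h1 : a < b) (h2 : b < a') (h3 : a' < b') :
    windowIndex s n ℓ a = windowIndex s n ℓ b ↔ windowIndex s n ℓ a' = windowIndex s n ℓ b' := by
  obtain ⟨e1, -, e2, -⟩ := h.eq_of_crossing hU h1 h2 h3 hb.2.1 ha.2.2.1 hb.2.2.1 hb.2.2.2.2
  have hb' := hb.2.1
  rw [windowIndex_eq_iff h1.le (by omega), windowIndex_eq_iff h3.le hb']
  constructor
  · intro hg u hu hu'
    have h4 := e2 (u - a') (by omega)
    rw [show a' + (u - a') = u by omega] at h4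
    exact (hg (a + (u - a')) (by omega) (by omega)).congr (by omega) h4.symm
  · intro hg u hu hu'
    have h4 := e2 (u - a) (by omega)
    rw [show a + (u - a) = u by omega] at h4
    exact (hg (a' + (u - a)) (by omega) (by omega)).congr (by omega) h4

/-- The starting times of the chords from one window to another form an interval. -/
theorem windowIndex_partner_of_between_left (h : IsUniquePath step n s w)
    (hU : HasDistinctFactors ℓ n w) (hℓ : 0 < ℓ) {j m k : ℕ} (hj : IsGoodTime s n ℓ j)
    (hk : IsGoodTime s n ℓ k) (hjm : j < m) (hmk : m < k)
    (hW : windowIndex s n ℓ j = windowIndex s n ℓ k)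
    (hW' : windowIndex s n ℓ (partner s n ℓ j) = windowIndex s n ℓ (partner s n ℓ k))
    (hlt : windowIndex s n ℓ j < windowIndex s n ℓ (partner s n ℓ j)) :
    IsGoodTime s n ℓ m ∧ windowIndex s n ℓ m = windowIndex s n ℓ j ∧
      windowIndex s n ℓ (partner s n ℓ m) = windowIndex s n ℓ (partner s n ℓ j) := by
  have hkn := hk.le
  have hgood := (windowIndex_eq_iff (hjm.trans hmk).le hkn).1 hW
  have hm : IsGoodTime s n ℓ m := hgood m hjm hmk.le
  have hWm : windowIndex s n ℓ j = windowIndex s n ℓ m :=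
    (windowIndex_eq_iff hjm.le hm.le).2 fun u h1 h2 => hgood u h1 (by omega)
  refine ⟨hm, hWm.symm, ?_⟩
  have hne := h.windowIndex_partner_ne hU hℓ hm
  -- both partners lie beyond the window of `j` and `k`
  have hjk : k < partner s n ℓ j := by
    by_contra! hle
    have := windowIndex_mono (s := s) (n := n) (ℓ := ℓ) hle
    omega
  have hkk : k < partner s n ℓ k := by
    by_contra! hle
    have := windowIndex_mono (s := s) (n := n) (ℓ := ℓ) hle
    omega
  have cj := hj.isChord_of_lt (by omega)
  have ck := hk.isChord_of_lt hkk
  rcases lt_or_ge (partner s n ℓ m) m with hmm | hmm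
  · have hmj : partner s n ℓ m < j := by
      by_contra! hle
      apply hne
      have h1 := windowIndex_mono (s := s) (n := n) (ℓ := ℓ) hle
      have h2 := windowIndex_mono (s := s) (n := n) (ℓ := ℓ) hmm.le
      omega
    exfalso
    have cm := hm.isChord_of_gt hmm
    -- the crossing carries `k` to a visit before `j`
    obtain ⟨e1, -, e2, -⟩ := h.eq_of_crossing hU hmj hjm (by omega) cj.2.1 cm.2.2.1 cj.2.2.1
      cj.2.2.2.2
    have h3 := e2 (k - m) (by omega)
    rw [show m + (k - m) = k by omega] at h3
    have := hk.eq_partner (by omega) h3 (by omega)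
    omega
  · have hmk' : k < partner s n ℓ m := by
      by_contra! hle
      apply hne
      have h1 := windowIndex_mono (s := s) (n := n) (ℓ := ℓ) hle
      have h2 := windowIndex_mono (s := s) (n := n) (ℓ := ℓ) hmm
      omega
    have cm := hm.isChord_of_lt (by omega)
    rcases lt_or_ge (partner s n ℓ m) (partner s n ℓ k) with h1 | h1
    · rw [hW']
      exact (h.windowIndex_eq_iff_of_crossing hU cm ck hmk hmk' h1).1 (by omega)
    rcases lt_or_ge (partner s n ℓ j) (partner s n ℓ m) with h2 | h2
    · exact ((h.windowIndex_eq_iff_of_crossing hU cj cm hjm (by omega) h2).1 hWm).symm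
    have h3 := windowIndex_mono (s := s) (n := n) (ℓ := ℓ) h1
    have h4 := windowIndex_mono (s := s) (n := n) (ℓ := ℓ) h2
    omega

/-- The end times of the chords from one window to another form an interval. -/
theorem windowIndex_partner_of_between_right (h : IsUniquePath step n s w)
    (hU : HasDistinctFactors ℓ n w) (hℓ : 0 < ℓ) {j m k : ℕ} (hj : IsGoodTime s n ℓ j)
    (hk : IsGoodTime s n ℓ k) (hjm : j < m) (hmk : m < k)
    (hW : windowIndex s n ℓ j = windowIndex s n ℓ k)
    (hW' : windowIndex s n ℓ (partner s n ℓ j) = windowIndex s n ℓ (partner s n ℓ k))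
    (hlt : windowIndex s n ℓ (partner s n ℓ j) < windowIndex s n ℓ j) :
    IsGoodTime s n ℓ m ∧ windowIndex s n ℓ m = windowIndex s n ℓ j ∧
      windowIndex s n ℓ (partner s n ℓ m) = windowIndex s n ℓ (partner s n ℓ j) := by
  have hkn := hk.le
  have hgood := (windowIndex_eq_iff (hjm.trans hmk).le hkn).1 hW
  have hm : IsGoodTime s n ℓ m := hgood m hjm hmk.le
  have hWm : windowIndex s n ℓ j = windowIndex s n ℓ m :=
    (windowIndex_eq_iff hjm.le hm.le).2 fun u h1 h2 => hgood u h1 (by omega)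
  refine ⟨hm, hWm.symm, ?_⟩
  have hne := h.windowIndex_partner_ne hU hℓ hm
  have hjj : partner s n ℓ j < j := by
    by_contra! hle
    have := windowIndex_mono (s := s) (n := n) (ℓ := ℓ) hle
    omega
  have hkj : partner s n ℓ k < j := by
    by_contra! hle
    have := windowIndex_mono (s := s) (n := n) (ℓ := ℓ) hle
    omega
  have cj := hj.isChord_of_gt hjj
  have ck := hk.isChord_of_gt (by omega)
  rcases lt_or_ge m (partner s n ℓ m) with hmm | hmm
  · have hmk' : k < partner s n ℓ m := by
      by_contra! hle
      apply hne
      have h1 := windowIndex_mono (s := s) (n := n) (ℓ := ℓ) hle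
      have h2 := windowIndex_mono (s := s) (n := n) (ℓ := ℓ) hmm.le
      omega
    exfalso
    have cm := hm.isChord_of_lt hmm
    -- the crossing carries `j` to a visit after `k`
    obtain ⟨e1, -, e2, -⟩ := h.eq_of_crossing hU (by omega) hmk hmk' cm.2.1 ck.2.2.1 cm.2.2.1
      cm.2.2.2.2
    have h3 := e2 (j - partner s n ℓ k) (by omega)
    rw [show partner s n ℓ k + (j - partner s n ℓ k) = j by omega] at h3
    have := cm.2.1
    have := hj.eq_partner (by omega) h3.symm (by omega)
    omega
  · have hmj : partner s n ℓ m < j := by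
      by_contra! hle
      apply hne
      have h1 := windowIndex_mono (s := s) (n := n) (ℓ := ℓ) hle
      have h2 := windowIndex_mono (s := s) (n := n) (ℓ := ℓ) hmm
      omega
    have cm := hm.isChord_of_gt (by omega)
    rcases lt_or_ge (partner s n ℓ m) (partner s n ℓ k) with h1 | h1
    · rw [hW']
      exact (h.windowIndex_eq_iff_of_crossing hU cm ck h1 (by omega) hmk).2 (by omega)
    rcases lt_or_ge (partner s n ℓ j) (partner s n ℓ m) with h2 | h2
    · exact ((h.windowIndex_eq_iff_of_crossing hU cj cm h2 (by omega) hjm).2 hWm).symm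
    have h3 := windowIndex_mono (s := s) (n := n) (ℓ := ℓ) h1
    have h4 := windowIndex_mono (s := s) (n := n) (ℓ := ℓ) h2
    omega

end IsUniquePath

end Window

theorem Finset.exists_eq_Ico_of_convex {J : Finset ℕ} (hne : J.Nonempty)
    (h : ∀ a ∈ J, ∀ b ∈ J, ∀ m, a < m → m < b → m ∈ J) :
    ∃ p, J = Finset.Ico p (p + J.card) := by
  have hIcc : J = Finset.Icc (J.min' hne) (J.max' hne) := by
    ext m
    rw [Finset.mem_Icc]
    constructor
    · exact fun hm => ⟨J.min'_le m hm, J.le_max' m hm⟩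
    · rintro ⟨h1, h2⟩
      rcases h1.lt_or_eq with h1 | h1
      · rcases h2.lt_or_eq with h2 | h2
        · exact h _ (J.min'_mem hne) _ (J.max'_mem hne) m h1 h2
        · exact h2 ▸ J.max'_mem hne
      · exact h1 ▸ J.min'_mem hne
  have hle := J.min'_le _ (J.max'_mem hne)
  have hcard := congrArg Finset.card hIcc
  rw [Nat.card_Icc] at hcard
  refine ⟨J.min' hne, ?_⟩
  rw [hcard]
  conv_lhs => rw [hIcc]
  ext m
  simp only [Finset.mem_Icc, Finset.mem_Ico]
  omega

namespace IsUniquePath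

variable {α σ : Type*} {step : σ → α → σ → Prop} {s : ℕ → σ} {w : ℕ → α} {n ℓ : ℕ}

/-- If there are few states, a pigeonhole argument on the windows gives a long interval of times
whose partners form another interval. -/
theorem exists_interval [Fintype σ] (h : IsUniquePath step n s w) (hU : HasDistinctFactors ℓ n w)
    (hℓ : 0 < ℓ) {K T₀ : ℕ} (hK : (badTimes s n ℓ).card ≤ K)
    (hsize : (K + 1) ^ 2 * T₀ + K ≤ n) :
    ∃ p p' T, T₀ < T ∧ p + T ≤ p' ∧ p' + T ≤ n + 1 ∧
      (∀ j, p ≤ j → j < p + T → IsGoodTime s n ℓ j) ∧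
      (∀ j, p ≤ j → j < p + T → p' ≤ partner s n ℓ j ∧ partner s n ℓ j < p' + T) ∧
      ∀ y, p' ≤ y → y < p' + T → ∃ j, p ≤ j ∧ j < p + T ∧ partner s n ℓ j = y := by
  classical
  let A : Finset ℕ := (Finset.range (n + 1)).filter fun t => IsGoodTime s n ℓ t
  have hA : A.card + (badTimes s n ℓ).card = n + 1 := by
    have := Finset.card_filter_add_card_filter_not (s := Finset.range (n + 1))
      (fun t => IsGoodTime s n ℓ t)
    simpa [A, badTimes] using this
  let c : ℕ → ℕ × ℕ := fun t => (windowIndex s n ℓ t, windowIndex s n ℓ (partner s n ℓ t))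
  have hW : ∀ t, windowIndex s n ℓ t < K + 1 := fun t =>
    Nat.lt_succ_of_le ((Finset.card_filter_le _ _).trans hK)
  obtain ⟨⟨a, b⟩, -, hab⟩ := Finset.exists_lt_card_fiber_of_mul_lt_card_of_maps_to
    (s := A) (t := Finset.range (K + 1) ×ˢ Finset.range (K + 1)) (f := c) (n := T₀)
    (fun t _ => by
      rw [Finset.mem_product, Finset.mem_range, Finset.mem_range]
      exact ⟨hW _, hW _⟩)
    (by
      rw [Finset.card_product, Finset.card_range, ← pow_two]
      omega)
  -- the times with a chord from window `a` to window `b`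
  let J : ℕ → ℕ → Finset ℕ := fun a b => A.filter fun t => c t = (a, b)
  have hJ : ∀ a b t, t ∈ J a b ↔ IsGoodTime s n ℓ t ∧ windowIndex s n ℓ t = a ∧
      windowIndex s n ℓ (partner s n ℓ t) = b := by
    intro a b t
    simp only [J, A, c, Finset.mem_filter, Finset.mem_range, Prod.mk.injEq]
    constructor
    · exact fun ht => ⟨ht.1.2, ht.2⟩
    · exact fun ht => ⟨⟨Nat.lt_succ_of_le ht.1.le, ht.1⟩, ht.2⟩
  have himage : ∀ a b, J b a = (J a b).image (partner s n ℓ) := by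
    intro a b
    ext t
    simp only [Finset.mem_image, hJ]
    constructor
    · rintro ⟨h1, h2, h3⟩
      exact ⟨partner s n ℓ t, ⟨h1.isGoodTime_partner, h3, by rw [h1.partner_partner, h2]⟩,
        h1.partner_partner⟩
    · rintro ⟨u, ⟨h1, h2, h3⟩, rfl⟩
      exact ⟨h1.isGoodTime_partner, h3, by rw [h1.partner_partner, h2]⟩
  have hcard : ∀ a b, (J b a).card = (J a b).card := by
    intro a b
    rw [himage]
    refine Finset.card_image_of_injOn fun t ht u hu htu => ?_
    rw [Finset.mem_coe, hJ] at ht hu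
    rw [← ht.1.partner_partner, ← hu.1.partner_partner]
    exact congrArg _ htu
  have hJab : T₀ < (J a b).card := hab
  have hne : a ≠ b := by
    rintro rfl
    obtain ⟨t, ht⟩ := Finset.card_pos.1 (Nat.zero_lt_of_lt hJab)
    rw [hJ] at ht
    exact h.windowIndex_partner_ne hU hℓ ht.1 (ht.2.1.trans ht.2.2.symm)
  obtain ⟨a, b, hlt, hJab⟩ : ∃ a b, a < b ∧ T₀ < (J a b).card := by
    rcases lt_or_gt_of_ne hne with hlt | hlt
    · exact ⟨a, b, hlt, hJab⟩
    · exact ⟨b, a, hlt, by rwa [hcard]⟩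
  have hJne : (J a b).Nonempty := Finset.card_pos.1 (Nat.zero_lt_of_lt hJab)
  have hJne' : (J b a).Nonempty := by
    rw [himage]
    exact hJne.image _
  obtain ⟨p, hp⟩ := Finset.exists_eq_Ico_of_convex hJne fun j hj k hk m hjm hmk => by
    rw [hJ] at hj hk ⊢
    have := h.windowIndex_partner_of_between_left hU hℓ hj.1 hk.1 hjm hmk
      (hj.2.1.trans hk.2.1.symm) (hj.2.2.trans hk.2.2.symm) (by omega)
    exact ⟨this.1, this.2.1.trans hj.2.1, this.2.2.trans hj.2.2⟩
  obtain ⟨p', hp'⟩ := Finset.exists_eq_Ico_of_convex hJne' fun j hj k hk m hjm hmk => by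
    rw [hJ] at hj hk ⊢
    have := h.windowIndex_partner_of_between_right hU hℓ hj.1 hk.1 hjm hmk
      (hj.2.1.trans hk.2.1.symm) (hj.2.2.trans hk.2.2.symm) (by omega)
    exact ⟨this.1, this.2.1.trans hj.2.1, this.2.2.trans hj.2.2⟩
  rw [hcard] at hp'
  set T := (J a b).card with hT
  have hmem : ∀ j, j ∈ J a b ↔ p ≤ j ∧ j < p + T := fun j => by
    rw [hp, Finset.mem_Ico]
  have hmem' : ∀ j, j ∈ J b a ↔ p' ≤ j ∧ j < p' + T := fun j => by
    rw [hp', Finset.mem_Ico]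
  refine ⟨p, p', T, hJab, ?_, ?_, ?_, ?_, ?_⟩
  · -- the window `a` precedes the window `b`
    have h1 := (hJ a b _).1 ((hmem (p + T - 1)).2 (by omega))
    have h2 := (hJ b a _).1 ((hmem' p').2 (by omega))
    by_contra! hc
    have := windowIndex_mono (s := s) (n := n) (ℓ := ℓ) (by omega : p' ≤ p + T - 1)
    omega
  · have := ((hJ b a _).1 ((hmem' (p' + T - 1)).2 (by omega))).1.le
    omega
  · exact fun j h1 h2 => ((hJ a b _).1 ((hmem j).2 ⟨h1, h2⟩)).1
  · intro j h1 h2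
    rw [← hmem', himage]
    exact Finset.mem_image_of_mem _ ((hmem j).2 ⟨h1, h2⟩)
  · intro y h1 h2
    have hy := (hmem' y).2 ⟨h1, h2⟩
    rw [himage, Finset.mem_image] at hy
    obtain ⟨j, hj, rfl⟩ := hy
    exact ⟨j, ((hmem j).1 hj).1, ((hmem j).1 hj).2, rfl⟩

end IsUniquePath

/-! ### Nested blocks -/

/-- A map from `[p, p + T)` onto `[p', p' + T)` which reverses the order, apart from short
stretches on which it is a shift, reverses the order of a sequence of blocks, delimited by the
sequence `f`, each of which it shifts. -/
theorem exists_blocks {π : ℕ → ℕ} {p p' T ℓ : ℕ} (hℓ : 0 < ℓ)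
    (hmaps : ∀ j, p ≤ j → j < p + T → p' ≤ π j ∧ π j < p' + T)
    (hsurj : ∀ y, p' ≤ y → y < p' + T → ∃ j, p ≤ j ∧ j < p + T ∧ π j = y)
    (hinj : ∀ j k, p ≤ j → j < k → k < p + T → π j ≠ π k)
    (hcross : ∀ j k, p ≤ j → j < k → k < p + T → π j < π k → π k = π j + (k - j) ∧ k - j < ℓ) :
    ∃ f : ℕ → ℕ, f 0 = p ∧ ∀ i, f i < p + T → f i < f (i + 1) ∧ f (i + 1) ≤ f i + ℓ ∧
      f (i + 1) ≤ p + T ∧ ∀ t < f (i + 1) - f i, π (f i + t) + f (i + 1) = p + p' + T + t := by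
  -- `π` maps `[x, p + T)` onto the remaining initial part of `[p', p' + T)`
  let Inv : ℕ → Prop := fun x => p ≤ x ∧ (∀ j, x ≤ j → j < p + T → π j + x < p + p' + T) ∧
    ∀ y, p' ≤ y → y + x < p + p' + T → ∃ j, x ≤ j ∧ j < p + T ∧ π j = y
  have hstep : ∀ x, Inv x → x < p + T → ∃ x', Inv x' ∧ x < x' ∧ x' ≤ x + ℓ ∧ x' ≤ p + T ∧
      ∀ t < x' - x, π (x + t) + x' = p + p' + T + t := by
    rintro x ⟨hpx, hx1, hx2⟩ hxT
    -- the block ends at the preimage of the largest remaining value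
    obtain ⟨m, hm1, hm2, hm3⟩ := hx2 (p + p' + T - x - 1) (by omega) (by omega)
    have hblock : ∀ j, x ≤ j → j ≤ m → π j + (m - j) = p + p' + T - x - 1 ∧ m - j < ℓ := by
      intro j hj1 hj2
      rcases hj2.lt_or_eq with hlt | rfl
      · have h1 := hx1 j hj1 (by omega)
        have h2 := hinj j m (by omega) hlt hm2
        have := hcross j m (by omega) hlt hm2 (by omega)
        omega
      · omega
    have hxm := hblock x le_rfl hm1
    refine ⟨m + 1, ⟨by omega, ?_, ?_⟩, by omega, by omega, by omega, ?_⟩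
    · intro j hj1 hj2
      have h1 := hx1 j (by omega) hj2
      by_contra! hc
      have h2 := hmaps j (by omega) hj2
      have h3 := hblock (x + (π j - π x)) (by omega) (by omega)
      exact hinj (x + (π j - π x)) j (by omega) (by omega) hj2 (by omega)
    · intro y hy1 hy2
      obtain ⟨j, hj1, hj2, rfl⟩ := hx2 y hy1 (by omega)
      refine ⟨j, ?_, hj2, rfl⟩
      by_contra! hc
      have := hblock j hj1 (by omega)
      omega
    · intro t ht
      have := hblock (x + t) (by omega) (by omega)
      omega
  have hInv : Inv p := ⟨le_rfl, fun j h1 h2 => by have := hmaps j h1 h2; omega,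
    fun y h1 h2 => hsurj y h1 (by omega)⟩
  choose! g hg using hstep
  let f : ℕ → ℕ := Nat.rec p fun _ (x : ℕ) => if x < p + T then g x else x
  have hsucc : ∀ i, f i < p + T → f (i + 1) = g (f i) := fun i hi => if_pos hi
  have hsucc' : ∀ i, ¬ f i < p + T → f (i + 1) = f i := fun i hi =>
    if_neg hi
  have hf : ∀ i, Inv (f i) := by
    intro i
    induction i with
    | zero => exact hInv
    | succ i ih =>
      rcases lt_or_ge (f i) (p + T) with hlt | hlt
      · rw [hsucc i hlt]
        exact (hg _ ih hlt).1
      · rwa [hsucc' i hlt.not_gt]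
  refine ⟨f, rfl, fun i hi => ?_⟩
  rw [hsucc i hi]
  exact (hg _ (hf i) hi).2

/-- The numerical semigroup generated by a finite set contains all large multiples of the greatest
common divisor. -/
theorem mem_closure_of_gcd_dvd {S : Finset ℕ} {B : ℕ} (hne : S.Nonempty)
    (hS : ∀ v ∈ S, 0 < v ∧ v ≤ B) {m : ℕ} (hm : S.card * B ^ 2 ≤ m) (hg : S.gcd id ∣ m) :
    m ∈ AddSubmonoid.closure (S : Set ℕ) := by
  induction hne using Finset.Nonempty.cons_induction generalizing m with
  | singleton v =>
    simp only [Finset.gcd_singleton, id, normalize_eq] at hg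
    obtain ⟨c, rfl⟩ := hg
    rw [mul_comm, ← smul_eq_mul]
    exact AddSubmonoid.nsmul_mem _ (AddSubmonoid.subset_closure (by simp)) c
  | cons v S hv hne ih =>
    have hSB : ∀ v ∈ S, 0 < v ∧ v ≤ B := fun u hu => hS u (Finset.mem_cons_of_mem hu)
    obtain ⟨hv0, hvB⟩ := hS v (Finset.mem_cons_self v S)
    set g := S.gcd id with hgdef
    obtain ⟨u, hu⟩ := hne
    have hgu : g ∣ u := Finset.gcd_dvd hu
    have hg0 : 0 < g := Nat.pos_of_dvd_of_pos hgu (hSB u hu).1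
    have hgB : g ≤ B := (Nat.le_of_dvd (hSB u hu).1 hgu).trans (hSB u hu).2
    rw [Finset.gcd_cons, id] at hg
    obtain ⟨x, y, hxy⟩ := Int.gcd_dvd_iff.1
      (show Int.gcd (v : ℤ) (g : ℤ) ∣ m by rw [Int.gcd_natCast_natCast]; exact hg)
    -- a number `c < g` of copies of `v` makes the rest divisible by `g`
    obtain ⟨c, hc⟩ := Int.eq_ofNat_of_zero_le (Int.emod_nonneg x (by omega : (g : ℤ) ≠ 0))
    have hcg : c < g := by
      have := Int.emod_lt_of_pos x (by omega : (0 : ℤ) < g)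
      omega
    have hcv : c * v ≤ B ^ 2 := by
      rw [pow_two]
      exact Nat.mul_le_mul (by omega) hvB
    rw [Finset.card_cons, add_mul, one_mul] at hm
    have hrest : g ∣ m - c * v := by
      have h1 : ((m - c * v : ℕ) : ℤ) = g * (v * (x / g) + y) := by
        rw [Nat.cast_sub (by omega), hxy]
        have := Int.emod_add_mul_ediv x g
        rw [hc] at this
        push_cast
        linear_combination (-(v : ℤ)) * this
      exact_mod_cast (Dvd.intro _ h1.symm : (g : ℤ) ∣ ((m - c * v : ℕ) : ℤ))
    have h2 := ih hSB (by omega) hrest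
    rw [show m = m - c * v + c * v by omega]
    refine AddSubmonoid.add_mem _ (AddSubmonoid.closure_mono (by simp) h2) ?_
    rw [← smul_eq_mul]
    exact AddSubmonoid.nsmul_mem _ (AddSubmonoid.subset_closure (by simp)) c

/-- The word `w` consists, between the positions `p` and `q`, of `2 * N` blocks on the left, and of
the same blocks in the reverse order on the right. The last letter of each block is exempt, as it
labels an edge to another block. The sum of the lengths of two successive blocks is a multiple
`≥ 3` of `g`, and the lengths of every other block are `β` modulo `g`. -/
def IsNest {α : Type*} (w : ℕ → α) (g β : ℕ) : ℕ → ℕ → ℕ → Prop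
  | 0, _, _ => True
  | N + 1, p, q => ∃ b b', 0 < b ∧ 0 < b' ∧ b % g = β ∧ g ∣ b + b' ∧ 3 ≤ b + b' ∧
      p + 2 * (b + b') ≤ q ∧ (∀ t, t + 1 < b → w (p + t) = w (q - b + t)) ∧
      (∀ t, t + 1 < b' → w (p + b + t) = w (q - (b + b') + t)) ∧
      IsNest w g β N (p + (b + b')) (q - (b + b'))

/-- The starting times `f 0 < f 1 < ⋯ < f m` of successive blocks of length at most `ℓ`. The path
returns to the states of these blocks, with the blocks in the reverse order: the block
`[f i, f (i + 1))` is repeated at `[c - f (i + 1), c - f i)`. -/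
structure IsBlockSequence {α σ : Type*} (s : ℕ → σ) (w : ℕ → α) (n ℓ m c : ℕ) (f : ℕ → ℕ) :
    Prop where
  lt : ∀ i < m, f i < f (i + 1)
  le : ∀ i < m, f (i + 1) ≤ f i + ℓ
  isChord : ∀ i < m, ∀ t < f (i + 1) - f i, IsChord s n ℓ (f i + t) (c - f (i + 1) + t)
  label : ∀ i < m, ∀ t, t + 1 < f (i + 1) - f i → w (f i + t) = w (c - f (i + 1) + t)
  center : 2 * f m + 8 * ℓ ^ 3 ≤ c
  bound : c ≤ n + 1 + f 0

/-- With few states, the chords between the two long intervals form a sequence of blocks. -/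
theorem IsUniquePath.exists_isBlockSequence {α σ : Type*} [Fintype σ] {step : σ → α → σ → Prop}
    {s : ℕ → σ} {w : ℕ → α} {n ℓ : ℕ} (h : IsUniquePath step n s w)
    (hU : HasDistinctFactors ℓ n w) (hℓ : 0 < ℓ) {K : ℕ} (hK : (badTimes s n ℓ).card ≤ K)
    (hsize : (K + 1) ^ 2 * (20 * ℓ ^ 3) + K ≤ n) :
    ∃ c f, IsBlockSequence s w n ℓ (2 * ℓ + 2) c f := by
  obtain ⟨p, p', T, hT, hpp', hp'n, hgood, hmaps, hsurj⟩ := h.exists_interval hU hℓ hK hsize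
  have hchord : ∀ j, p ≤ j → j < p + T → IsChord s n ℓ j (partner s n ℓ j) := fun j h1 h2 =>
    (hgood j h1 h2).isChord_of_lt (by have := hmaps j h1 h2; omega)
  have hcross : ∀ j k, p ≤ j → j < k → k < p + T → partner s n ℓ j < partner s n ℓ k →
      partner s n ℓ k - partner s n ℓ j = k - j ∧ k - j < ℓ ∧
        ∀ i < k - j, w (j + i) = w (partner s n ℓ j + i) := by
    intro j k h1 h2 h3 hlt
    have cj := hchord j h1 (by omega)
    have ck := hchord k (by omega) h3
    have := hmaps j h1 (by omega)
    have := h.eq_of_crossing hU h2 (by omega) hlt ck.2.1 cj.2.2.1 ck.2.2.1 ck.2.2.2.2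
    exact ⟨this.1, this.2.1, this.2.2.2⟩
  obtain ⟨f, hf0, hf⟩ := exists_blocks hℓ hmaps hsurj
    (fun j k h1 h2 h3 heq => by
      have h4 := (hgood j h1 (by omega)).partner_partner
      have h5 := (hgood k (by omega) h3).partner_partner
      rw [← h4, ← h5] at h2
      exact h2.ne (congrArg _ heq))
    (fun j k h1 h2 h3 hlt => by
      have := hcross j k h1 h2 h3 hlt
      omega)
  have hℓ3 : ℓ ^ 2 ≤ ℓ ^ 3 := Nat.pow_le_pow_right hℓ (by norm_num)
  have hℓ2 : ℓ ≤ ℓ ^ 2 := Nat.le_self_pow (by norm_num) ℓ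
  have hlen : ∀ i ≤ 2 * ℓ + 2, i * ℓ ≤ 4 * ℓ ^ 2 := by
    intro i hi
    calc i * ℓ ≤ (2 * ℓ + 2) * ℓ := Nat.mul_le_mul_right _ hi
      _ ≤ 4 * ℓ ^ 2 := by ring_nf; omega
  -- the blocks are so short that many of them are available
  have hfle : ∀ i ≤ 2 * ℓ + 2, p ≤ f i ∧ f i ≤ p + i * ℓ := by
    intro i
    induction i with
    | zero => omega
    | succ i ih =>
      intro hi
      have h1 := ih (by omega)
      have h2 := hlen i (by omega)
      have h3 := hf i (by omega)
      rw [add_mul]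
      omega
  have hfT : ∀ i ≤ 2 * ℓ + 2, p ≤ f i ∧ f i < p + T := fun i hi => by
    have := hfle i hi
    have := hlen i hi
    omega
  have hpartner : ∀ i < 2 * ℓ + 2, ∀ t < f (i + 1) - f i,
      partner s n ℓ (f i + t) = p + p' + T - f (i + 1) + t := by
    intro i hi t ht
    obtain ⟨h2, h3, h4, h5⟩ := hf i (hfT i hi.le).2
    have := h5 t ht
    omega
  refine ⟨p + p' + T, f, ⟨fun i hi => (hf i (hfT i hi.le).2).1, fun i hi =>
    (hf i (hfT i hi.le).2).2.1, fun i hi t ht => ?_, fun i hi t ht => ?_, ?_, by omega⟩⟩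
  · rw [← hpartner i hi t ht]
    have := hfT i hi.le
    have := hfT (i + 1) hi
    exact hchord _ (by omega) (by omega)
  · have h1 := hfT i hi.le
    have h2 := hfT (i + 1) hi
    have h3 := hpartner i hi 0 (by omega)
    have h4 := hpartner i hi (t + 1) ht
    rw [add_zero, add_zero] at h3
    have := (hcross (f i) (f i + (t + 1)) h1.1 (by omega) (by omega) (by omega)).2.2 t (by omega)
    rwa [h3] at this
  · have h1 := hfle (2 * ℓ + 2) le_rfl
    have h2 := hlen (2 * ℓ + 2) le_rfl
    omega

namespace IsBlockSequence

variable {α σ : Type*} {step : σ → α → σ → Prop} {s : ℕ → σ} {w : ℕ → α} {n ℓ m c : ℕ}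
  {f : ℕ → ℕ}

theorem mono (hf : IsBlockSequence s w n ℓ m c f) {i j : ℕ} (hij : i ≤ j) (hj : j ≤ m) :
    f i ≤ f j := by
  induction j, hij using Nat.le_induction with
  | base => exact le_rfl
  | succ j hij ih => exact (ih (by omega)).trans (hf.lt j (by omega)).le

/-- All times of the first passage through the blocks start a chord. -/
theorem exists_isChord (hf : IsBlockSequence s w n ℓ m c f) {i t : ℕ} (hi : i ≤ m)
    (h1 : f 0 ≤ t) (h2 : t < f i) : ∃ u, IsChord s n ℓ t u := by
  induction i with
  | zero => omega
  | succ i ih =>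
    by_cases hlt : t < f i
    · exact ih (by omega) hlt
    · have := hf.isChord i (by omega) (t - f i) (by omega)
      rw [show f i + (t - f i) = t by omega] at this
      exact ⟨_, this⟩

/-- Two successive blocks form a cycle. -/
theorem exists_cycle (hf : IsBlockSequence s w n ℓ m c f) (h : IsUniquePath step n s w) {i : ℕ}
    (hi : i + 2 ≤ m) : ∃ l, IsWalk step (s (f i)) l (s (f i)) ∧ l.length = f (i + 2) - f i ∧
      ∀ x ∈ l.map Prod.snd, ∃ t, f i ≤ t ∧ t < f (i + 2) ∧ x = s t := by
  have h1 := hf.lt i (by omega)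
  have h2 := hf.lt (i + 1) (by omega)
  rw [show i + 1 + 1 = i + 2 from rfl] at h2
  have h3 := hf.mono (show i + 2 ≤ m by omega) le_rfl
  have h4 := hf.center
  have h5 := hf.mono (Nat.zero_le i) (by omega)
  have h6 := hf.bound
  have c1 := hf.isChord i (by omega) 0 (by omega)
  have c2 := hf.isChord (i + 1) (by omega) (f (i + 2) - f (i + 1) - 1)
    (by rw [show i + 1 + 1 = i + 2 from rfl]; omega)
  rw [show i + 1 + 1 = i + 2 from rfl,
    show c - f (i + 2) + (f (i + 2) - f (i + 1) - 1) = c - f (i + 1) - 1 by omega,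
    show f (i + 1) + (f (i + 2) - f (i + 1) - 1) = f (i + 2) - 1 by omega] at c2
  rw [add_zero, add_zero] at c1
  have hn := c1.2.1
  have w1 := h.isWalk_pathSegment (i := f i) (j := f (i + 2) - 1) (by omega) (by omega)
  have w2 := h.isWalk_pathSegment (i := c - f (i + 1) - 1) (j := c - f (i + 1)) (by omega) hn
  rw [← c1.2.2.1, ← c2.2.2.1] at w2
  refine ⟨_, w1.append w2, by simp; omega, ?_⟩
  intro x hx
  obtain ⟨e, he, rfl⟩ := List.mem_map.1 hx
  rw [List.mem_append, mem_pathSegment, mem_pathSegment] at he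
  rcases he with ⟨t, ht1, ht2, rfl⟩ | ⟨t, ht1, ht2, rfl⟩
  · exact ⟨t + 1, by omega, by omega, rfl⟩
  · refine ⟨f i, le_rfl, by omega, ?_⟩
    rw [show t + 1 = c - f (i + 1) by omega, c1.2.2.1]

/-- A cycle of length two could replace an even number of steps between three visits to the same
state. -/
theorem three_le (hf : IsBlockSequence s w n ℓ m c f) (h : IsUniquePath step n s w)
    (hU : HasDistinctFactors ℓ n w) {t₁ t₂ t₃ : ℕ} (h12 : t₁ < t₂) (h23 : t₂ < t₃)
    (h3n : t₃ ≤ n) (e12 : s t₁ = s t₂) (e23 : s t₂ = s t₃) {i : ℕ} (hi : i + 2 ≤ m) :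
    3 ≤ f (i + 2) - f i := by
  have hclose := h.sub_lt_of_three_visits hU h12 h23 h3n e12 e23
  have h1 := hf.lt i (by omega)
  have h2 := hf.lt (i + 1) (by omega)
  rw [show i + 1 + 1 = i + 2 from rfl] at h2
  by_contra! hlt
  obtain ⟨l, hl, hlen, hmem⟩ := hf.exists_cycle h hi
  obtain ⟨j, j', hjj', hjn, hs, hst, hj1, hj2, heven⟩ : ∃ j j', j < j' ∧ j' ≤ n ∧ s j = s j' ∧
      s j' = s t₁ ∧ t₁ ≤ j ∧ j' ≤ t₃ ∧ 2 ∣ j' - j := by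
    by_cases hev : 2 ∣ t₂ - t₁
    · exact ⟨t₁, t₂, h12, by omega, e12, e12.symm, le_rfl, h23.le, hev⟩
    by_cases hev' : 2 ∣ t₃ - t₂
    · exact ⟨t₂, t₃, h23, h3n, e23, (e12.trans e23).symm, h12.le, le_rfl, hev'⟩
    · exact ⟨t₁, t₃, by omega, h3n, e12.trans e23, (e12.trans e23).symm, le_rfl, le_rfl,
        by omega⟩
  refine h.sub_notMem_closure (t := j') hjn hs hjj' le_rfl {2} ?_ ?_
  · intro v hv
    rw [Set.mem_singleton_iff.1 hv]
    have havoid : s j' ∉ l.map Prod.snd := by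
      intro hx
      obtain ⟨t, ht1, ht2, ht⟩ := hmem _ hx
      obtain ⟨u, hu⟩ := hf.exists_isChord hi ((hf.mono (Nat.zero_le i) (by omega)).trans ht1) ht2
      have v1 := hu.2.2.2.2 t₁ (by omega) (hst.symm.trans ht)
      have v2 := hu.2.2.2.2 t₂ (by omega) (e12.symm.trans (hst.symm.trans ht))
      have v3 := hu.2.2.2.2 t₃ (by omega) ((e12.trans e23).symm.trans (hst.symm.trans ht))
      omega
    -- one of the two visits to the base point remains
    have hc := hf.isChord i (by omega) 0 (by omega)
    rw [add_zero, add_zero] at hc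
    have hcn := hc.1.le.trans hc.2.1
    by_cases hout : f i ≤ j ∨ j' ≤ f i
    · exact ⟨f i, hcn, hout, l, hl, by omega, havoid⟩
    · have := hc.2.2.2.1
      refine ⟨c - f (i + 1), hc.2.1, Or.inr (by omega), l, ?_, by omega, havoid⟩
      rwa [← hc.2.2.1]
  · obtain ⟨d, hd⟩ := heven
    rw [hd, mul_comm, ← smul_eq_mul]
    exact AddSubmonoid.nsmul_mem _ (AddSubmonoid.subset_closure (Set.mem_singleton 2)) d

/-- The length of a deep chord is not a sum of lengths of cycles further out. -/
theorem sub_sub_notMem_closure (hf : IsBlockSequence s w n ℓ m c f)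
    (h : IsUniquePath step n s w) {k : ℕ} (hk : k + 2 ≤ m) :
    c - f (k + 1) - f k ∉ AddSubmonoid.closure {v | ∃ i, i + 2 ≤ k ∧ f (i + 2) - f i = v} := by
  have h1 := hf.lt k (by omega)
  have h2 := hf.lt (k + 1) (by omega)
  have h3 := hf.mono (show k + 1 + 1 ≤ m by omega) le_rfl
  have h4 := hf.center
  have c1 := hf.isChord k (by omega) 0 (by omega)
  have c2 := hf.isChord (k + 1) (by omega) 0 (by omega)
  rw [add_zero, add_zero] at c1 c2
  refine h.sub_notMem_closure (t := f (k + 1)) c1.2.1 c1.2.2.1 h1 (by omega) _ ?_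
  rintro v ⟨i, hi, rfl⟩
  obtain ⟨l, hl, hlen, hmem⟩ := hf.exists_cycle h (i := i) (by omega)
  have h5 := hf.mono (show i ≤ k by omega) (by omega)
  have h6 := hf.mono hi (by omega)
  refine ⟨f i, (h5.trans c1.1.le).trans c1.2.1, Or.inl h5, l, hl, hlen, fun hx => ?_⟩
  obtain ⟨t, ht1, ht2, ht⟩ := hmem _ hx
  have := c2.2.2.2.2 t (by have := c1.1; have := c1.2.1; omega) ht.symm
  omega

/-- The lengths of the outer cycles have a common divisor, as otherwise the length of a deep chord
would be a sum of such lengths. -/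
theorem exists_dvd (hf : IsBlockSequence s w n ℓ (2 * ℓ + 2) c f) (h : IsUniquePath step n s w)
    (hℓ : 0 < ℓ) : ∃ g, 2 ≤ g ∧ g ≤ 2 * ℓ ∧ ∀ i, i + 2 ≤ 2 * ℓ → g ∣ f (i + 2) - f i := by
  classical
  let S : Finset ℕ := (Finset.range (2 * ℓ - 1)).image fun i => f (i + 2) - f i
  have hmemS : ∀ v, v ∈ S ↔ ∃ i, i + 2 ≤ 2 * ℓ ∧ f (i + 2) - f i = v := by
    intro v
    simp only [S, Finset.mem_image, Finset.mem_range]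
    constructor <;> rintro ⟨i, hi, rfl⟩ <;> exact ⟨i, by omega, rfl⟩
  have h0 : f 2 - f 0 ∈ S := (hmemS _).2 ⟨0, by omega, rfl⟩
  have hSB : ∀ v ∈ S, 0 < v ∧ v ≤ 2 * ℓ := by
    intro v hv
    obtain ⟨i, hi, rfl⟩ := (hmemS v).1 hv
    have h1 := hf.lt i (by omega)
    have h2 := hf.lt (i + 1) (by omega)
    have h3 := hf.le i (by omega)
    have h4 := hf.le (i + 1) (by omega)
    rw [show i + 1 + 1 = i + 2 from rfl] at h2 h4
    omega
  have hScard : S.card ≤ 2 * ℓ := Finset.card_image_le.trans (by simp)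
  have hgS : ∀ v ∈ S, S.gcd id ∣ v := fun v hv => Finset.gcd_dvd hv
  have hg0 : 0 < S.gcd id := Nat.pos_of_dvd_of_pos (hgS _ h0) (hSB _ h0).1
  refine ⟨S.gcd id, ?_, (Nat.le_of_dvd (hSB _ h0).1 (hgS _ h0)).trans (hSB _ h0).2,
    fun i hi => hgS _ ((hmemS _).2 ⟨i, hi, rfl⟩)⟩
  by_contra! hlt
  have hdeep := hf.sub_sub_notMem_closure h (k := 2 * ℓ) le_rfl
  rw [show {v | ∃ i, i + 2 ≤ 2 * ℓ ∧ f (i + 2) - f i = v} = (S : Set ℕ) by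
    ext v; exact (hmemS v).symm] at hdeep
  refine hdeep (mem_closure_of_gcd_dvd ⟨_, h0⟩ hSB ?_ ?_)
  · have h1 : S.card * (2 * ℓ) ^ 2 ≤ 8 * ℓ ^ 3 :=
      (Nat.mul_le_mul_right _ hScard).trans (by ring_nf; exact le_rfl)
    have h2 := hf.center
    have h3 := hf.mono (show 2 * ℓ ≤ 2 * ℓ + 2 by omega) le_rfl
    have h4 := hf.mono (show 2 * ℓ + 1 ≤ 2 * ℓ + 2 by omega) le_rfl
    omega
  · rw [show S.gcd id = 1 by omega]
    exact one_dvd _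

/-- The labels of the steps inside the blocks are read twice. -/
theorem isNest (hf : IsBlockSequence s w n ℓ m c f) {g N : ℕ} (hN : 2 * N ≤ m)
    (hdvd : ∀ i, i + 2 ≤ 2 * N → g ∣ f (i + 2) - f i)
    (hthree : ∀ i, i + 2 ≤ 2 * N → 3 ≤ f (i + 2) - f i) :
    IsNest w g ((f 1 - f 0) % g) N (f 0) (c - f 0) := by
  -- every other block has the same length modulo `g`
  have hmod : ∀ i < N, (f (2 * i + 1) - f (2 * i)) % g = (f 1 - f 0) % g := by
    intro i
    induction i with
    | zero => exact fun _ => rfl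
    | succ i ih =>
      intro hi
      rw [← ih (by omega), show 2 * (i + 1) = 2 * i + 2 by ring]
      have d1 := hdvd (2 * i) (by omega)
      have d2 := hdvd (2 * i + 1) (by omega)
      have h1 := hf.lt (2 * i) (by omega)
      have h2 := hf.lt (2 * i + 1) (by omega)
      have h3 := hf.lt (2 * i + 2) (by omega)
      rw [show 2 * i + 1 + 1 = 2 * i + 2 from rfl] at h2
      rw [show 2 * i + 1 + 2 = 2 * i + 2 + 1 from rfl] at d2
      refine Nat.ModEq.add_right_cancel' (f (2 * i + 2) - f (2 * i + 1)) ?_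
      rw [show f (2 * i + 2 + 1) - f (2 * i + 2) + (f (2 * i + 2) - f (2 * i + 1)) =
        f (2 * i + 2 + 1) - f (2 * i + 1) by omega,
        show f (2 * i + 1) - f (2 * i) + (f (2 * i + 2) - f (2 * i + 1)) =
        f (2 * i + 2) - f (2 * i) by omega]
      exact (Nat.mod_eq_zero_of_dvd d2).trans (Nat.mod_eq_zero_of_dvd d1).symm
  have main : ∀ k ≤ N,
      IsNest w g ((f 1 - f 0) % g) k (f (2 * (N - k))) (c - f (2 * (N - k))) := by
    intro k
    induction k with
    | zero => exact fun _ => trivial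
    | succ k ih =>
      intro hk
      obtain ⟨i, hi⟩ : ∃ i, N - (k + 1) = i := ⟨_, rfl⟩
      have ih := ih (by omega)
      rw [show 2 * (N - k) = 2 * i + 2 by omega] at ih
      rw [hi]
      have h1 := hf.lt (2 * i) (by omega)
      have h2 := hf.lt (2 * i + 1) (by omega)
      rw [show 2 * i + 1 + 1 = 2 * i + 2 from rfl] at h2
      have h3 := hdvd (2 * i) (by omega)
      have h4 := hthree (2 * i) (by omega)
      have h5 := hf.mono (show 2 * i + 2 ≤ m by omega) le_rfl
      have h6 := hf.center
      have e : f (2 * i + 1) - f (2 * i) + (f (2 * i + 2) - f (2 * i + 1)) =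
        f (2 * i + 2) - f (2 * i) := by omega
      refine ⟨f (2 * i + 1) - f (2 * i), f (2 * i + 2) - f (2 * i + 1), by omega, by omega,
        hmod i (by omega), by rwa [e], by rwa [e], by omega, fun t ht => ?_, fun t ht => ?_, ?_⟩
      · rw [hf.label (2 * i) (by omega) t ht]
        congr 1
        omega
      · rw [show f (2 * i) + (f (2 * i + 1) - f (2 * i)) + t = f (2 * i + 1) + t by omega,
          hf.label (2 * i + 1) (by omega) t ht, show 2 * i + 1 + 1 = 2 * i + 2 from rfl]
        congr 1
        omega
      · rw [e, show f (2 * i) + (f (2 * i + 2) - f (2 * i)) = f (2 * i + 2) by omega,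
          show c - f (2 * i) - (f (2 * i + 2) - f (2 * i)) = c - f (2 * i + 2) by omega]
        exact ih
  simpa using main N le_rfl

end IsBlockSequence

/-- A unique path visits at least half as many states as there are times if its word has distinct
factors and no deep nests. Here `K` bounds the number of times without a chord, and the size of `n`
ensures that the intervals found by the pigeonhole principle have more than `20 * ℓ ^ 3` times. -/
theorem IsUniquePath.le_two_mul_card {α σ : Type*} [Fintype σ] {step : σ → α → σ → Prop}
    {s : ℕ → σ} {w : ℕ → α} {n ℓ : ℕ} (h : IsUniquePath step n s w)
    (hU : HasDistinctFactors ℓ n w) (hℓ : 0 < ℓ) {K : ℕ}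
    (hK : K = 2 * (2 * ℓ * (2 * (2 * ℓ + 1))))
    (hsize : (K + 1) ^ 2 * (20 * ℓ ^ 3) + K ≤ n)
    (hnest : ∀ g β p q, 2 ≤ g → g ≤ 2 * ℓ → β < g → p ≤ q → q ≤ n + 1 → ¬ IsNest w g β ℓ p q) :
    n + 1 ≤ 2 * Fintype.card σ := by
  by_contra! hq
  have hq' : 2 * Fintype.card σ ≤ n := Nat.lt_succ_iff.1 hq
  obtain ⟨t₁, t₂, t₃, h12, h23, h3n, e12, e23⟩ := exists_three_visits hq' s
  obtain ⟨c, f, hf⟩ := h.exists_isBlockSequence hU hℓ (hK ▸ h.card_badTimes_le hU hq') hsize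
  obtain ⟨g, hg2, hg2ℓ, hdvd⟩ := hf.exists_dvd h hℓ
  have h1 := hf.center
  have h2 := hf.bound
  have h3 := hf.mono (Nat.zero_le (2 * ℓ + 2)) le_rfl
  exact hnest g ((f 1 - f 0) % g) (f 0) (c - f 0) hg2 hg2ℓ (Nat.mod_lt _ (by omega)) (by omega)
    (by omega) (hf.isNest (by omega) hdvd fun i hi =>
      hf.three_le h hU h12 h23 h3n e12 e23 (by omega))

/-! ### Existence of generic words -/

section Count

/-- The extension of a word of length `n` to all positions. -/
def extendWord {n : ℕ} (x : Fin n → Bool) (i : ℕ) : Bool :=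
  if h : i < n then x ⟨i, h⟩ else false

/-- The word `x` with the letter at position `r` changed. -/
def flipAt {n : ℕ} (r : Fin n) (x : Fin n → Bool) : Fin n → Bool :=
  Function.update x r (!x r)

variable {n : ℕ}

theorem flipAt_flipAt (r : Fin n) (x : Fin n → Bool) : flipAt r (flipAt r x) = x := by
  simp [flipAt]

theorem extendWord_flipAt {r : Fin n} (x : Fin n → Bool) {i : ℕ} (h : i ≠ r) :
    extendWord (flipAt r x) i = extendWord x i := by
  unfold extendWord flipAt
  split_ifs with hi
  · rw [Function.update_of_ne]
    exact fun hc => h (congrArg Fin.val hc)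
  · rfl

theorem extendWord_flipAt_self (r : Fin n) (x : Fin n → Bool) :
    extendWord (flipAt r x) r = !extendWord x r := by
  simp [extendWord, flipAt]

/-- An equation between two letters, one of which is not constrained otherwise, holds for half of
the words. -/
theorem two_mul_card_filter_le (P : (Fin n → Bool) → Prop) [DecidablePred P] {l : ℕ} {r : Fin n}
    (hlr : l ≠ r) (hP : ∀ x, P x → P (flipAt r x)) :
    2 * (Finset.univ.filter fun x => P x ∧ extendWord x l = extendWord x r).card ≤
      (Finset.univ.filter P).card := by
  have h1 : (Finset.univ.filter fun x => P x ∧ extendWord x l = extendWord x r).card ≤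
      (Finset.univ.filter fun x => P x ∧ ¬ extendWord x l = extendWord x r).card := by
    refine Finset.card_le_card_of_injOn (flipAt r) ?_ ?_
    · intro x hx
      simp only [Finset.coe_filter, Finset.mem_univ, true_and, Set.mem_ofPred_eq] at hx ⊢
      refine ⟨hP x hx.1, ?_⟩
      rw [extendWord_flipAt x hlr, extendWord_flipAt_self, hx.2]
      simp
    · intro x _ y _ hxy
      rw [← flipAt_flipAt r x, hxy, flipAt_flipAt]
  have h2 := Finset.card_filter_add_card_filter_not (s := Finset.univ.filter P)
    (fun x => extendWord x l = extendWord x r)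
  rw [Finset.filter_filter, Finset.filter_filter] at h2
  omega

/-- If the letters at the positions `[r₀, r₀ + k)` are not constrained otherwise, the `2 ^ k`-th
part of the words have the same factors of length `k` at `l₀` and `r₀`. -/
theorem two_pow_mul_card_filter_le (P : (Fin n → Bool) → Prop) [DecidablePred P] {l₀ r₀ k : ℕ}
    (hlr : l₀ < r₀) (hr : r₀ + k ≤ n)
    (hP : ∀ r : Fin n, r₀ ≤ r → r < r₀ + k → ∀ x, P x → P (flipAt r x)) :
    2 ^ k * (Finset.univ.filter fun x => P x ∧
      ∀ t < k, extendWord x (l₀ + t) = extendWord x (r₀ + t)).card ≤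
        (Finset.univ.filter P).card := by
  classical
  induction k with
  | zero => simp
  | succ k ih =>
    have h1 := two_mul_card_filter_le (n := n) (fun x => P x ∧
      ∀ t < k, extendWord x (l₀ + t) = extendWord x (r₀ + t)) (l := l₀ + k)
      (r := ⟨r₀ + k, by omega⟩) (by simp; omega) (fun x hx => by
        refine ⟨hP _ (by simp) (by simp) x hx.1, fun t ht => ?_⟩
        rw [extendWord_flipAt x (by simp; omega), extendWord_flipAt x (by simp; omega)]
        exact hx.2 t ht)
    have h2 := ih (by omega) (fun r hr1 hr2 => hP r hr1 (by omega))
    have h3 : (Finset.univ.filter fun x => P x ∧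
        ∀ t < k + 1, extendWord x (l₀ + t) = extendWord x (r₀ + t)) =
        Finset.univ.filter fun x => (P x ∧
          ∀ t < k, extendWord x (l₀ + t) = extendWord x (r₀ + t)) ∧
          extendWord x (l₀ + k) = extendWord x ((⟨r₀ + k, by omega⟩ : Fin n) : ℕ) := by
      ext x
      simp only [Finset.mem_filter, Finset.mem_univ, true_and, and_assoc,
        Nat.forall_lt_succ_right]
    rw [h3, pow_succ, mul_assoc]
    exact (Nat.mul_le_mul_left _ h1).trans h2

theorem IsNest.congr {α : Type*} {w w' : ℕ → α} {g β N p q : ℕ} (h : IsNest w g β N p q)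
    (hw : ∀ i, p ≤ i → i < q → w i = w' i) : IsNest w' g β N p q := by
  induction N generalizing p q with
  | zero => trivial
  | succ N ih =>
    obtain ⟨b, b', h1, h2, h3, h4, h5, h6, h7, h8, h9⟩ := h
    refine ⟨b, b', h1, h2, h3, h4, h5, h6, fun t ht => ?_, fun t ht => ?_,
      ih h9 fun i hi hi' => hw i (by omega) (by omega)⟩
    · rw [← hw _ (by omega) (by omega), ← hw _ (by omega) (by omega)]
      exact h7 t ht
    · rw [← hw _ (by omega) (by omega), ← hw _ (by omega) (by omega)]
      exact h8 t ht

/-- The admissible pairs of lengths of two successive blocks of a nest. -/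
def blockPairs (n g β : ℕ) : Finset (ℕ × ℕ) :=
  (Finset.range (n + 2) ×ˢ Finset.range (n + 2)).filter fun b =>
    0 < b.1 ∧ 0 < b.2 ∧ b.1 % g = β ∧ g ∣ b.1 + b.2 ∧ 3 ≤ b.1 + b.2

theorem sum_quarter_pow_le (m : ℕ) : ∑ i ∈ Finset.range m, (1 / 4 : ℝ) ^ i ≤ 4 / 3 := by
  rw [geom_sum_eq (by norm_num)]
  have h1 : (0 : ℝ) ≤ (1 / 4) ^ m := by positivity
  have h2 : ((1 / 4 : ℝ) ^ m - 1) / (1 / 4 - 1) = 4 / 3 - 4 / 3 * (1 / 4) ^ m := by ring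
  linarith

/-- Two successive blocks of lengths `b` and `b'` impose `b + b' - 2` equations, so that this sum
bounds the proportion of words with a suitable pair of blocks. It is less than `1` because the pair
`(1, 1)` is excluded and the lengths are known modulo `g`. -/
theorem sum_blockPairs_le (n : ℕ) {g β : ℕ} (hg : 2 ≤ g) (hβ : β < g) :
    ∑ b ∈ blockPairs n g β, (1 / 2 : ℝ) ^ (b.1 + b.2 - 2) ≤ 8 / 9 := by
  -- the least positive lengths in the residue classes
  obtain ⟨a, ha0, hag, ha⟩ : ∃ a, 0 < a ∧ a ≤ g ∧ ∀ b, 0 < b → b % g = β → ∃ i, b = a + g * i := by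
    rcases Nat.eq_zero_or_pos β with rfl | hβ0
    · refine ⟨g, by omega, le_rfl, fun b hb hbg => ?_⟩
      obtain ⟨i, rfl⟩ := Nat.dvd_of_mod_eq_zero hbg
      obtain ⟨j, rfl⟩ : ∃ j, i = j + 1 := ⟨i - 1, by
        have := Nat.pos_of_mul_pos_left hb
        omega⟩
      exact ⟨j, by ring⟩
    · refine ⟨β, hβ0, hβ.le, fun b _ hbg => ⟨b / g, ?_⟩⟩
      rw [← hbg, Nat.mod_add_div]
  obtain ⟨a', ha'0, ha'g, ha'⟩ : ∃ a', 0 < a' ∧ a' ≤ g ∧ ∀ b b', 0 < b' → b % g = β → g ∣ b + b' →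
      ∃ j, b' = a' + g * j := by
    refine ⟨g - β, by omega, by omega, fun b b' hb' hbg hdvd => ?_⟩
    have h1 : g ∣ β + b' := by
      rw [← Nat.mod_add_div b g, hbg, add_right_comm] at hdvd
      exact (Nat.dvd_add_left (dvd_mul_right g _)).1 hdvd
    obtain ⟨k, hk⟩ := h1
    obtain ⟨j, rfl⟩ : ∃ j, k = j + 1 := ⟨k - 1, by
      have : 0 < g * k := by omega
      have := Nat.pos_of_mul_pos_left this
      omega⟩
    refine ⟨j, ?_⟩
    rw [mul_add] at hk
    omega
  let P : Finset (ℕ × ℕ) := (Finset.range (n + 2) ×ˢ Finset.range (n + 2)).filter fun i =>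
    3 ≤ a + a' + g * (i.1 + i.2)
  have hsub : blockPairs n g β ⊆ P.image fun i => (a + g * i.1, a' + g * i.2) := by
    rintro ⟨b, b'⟩ hb
    simp only [blockPairs, Finset.mem_filter, Finset.mem_product, Finset.mem_range] at hb
    obtain ⟨⟨h1, h2⟩, h3, h4, h5, h6, h7⟩ := hb
    obtain ⟨i, rfl⟩ := ha b h3 h5
    obtain ⟨j, rfl⟩ := ha' _ b' h4 h5 h6
    have hi : i ≤ g * i := Nat.le_mul_of_pos_left i (by omega)
    have hj : j ≤ g * j := Nat.le_mul_of_pos_left j (by omega)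
    simp only [P, Finset.mem_image, Finset.mem_filter, Finset.mem_product, Finset.mem_range]
    exact ⟨(i, j), ⟨⟨by omega, by omega⟩, by dsimp only; rw [mul_add]; omega⟩, rfl⟩
  have hstep : ∑ b ∈ blockPairs n g β, (1 / 2 : ℝ) ^ (b.1 + b.2 - 2) ≤
      ∑ i ∈ P, (1 / 2 : ℝ) ^ (a + a' - 2) * ((1 / 4) ^ i.1 * (1 / 4) ^ i.2) := by
    refine (Finset.sum_le_sum_of_subset_of_nonneg hsub fun _ _ _ => by positivity).trans ?_
    rw [Finset.sum_image]
    · refine Finset.sum_le_sum fun i _ => ?_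
      rw [show (1 / 4 : ℝ) = (1 / 2) ^ 2 by norm_num, ← pow_mul, ← pow_mul, ← pow_add, ← pow_add]
      refine pow_le_pow_of_le_one (by norm_num) (by norm_num) ?_
      have h1 : 2 * i.1 ≤ g * i.1 := Nat.mul_le_mul_right _ hg
      have h2 : 2 * i.2 ≤ g * i.2 := Nat.mul_le_mul_right _ hg
      simp only
      omega
    · intro i _ j _ hij
      simp only [Prod.mk.injEq, add_right_inj, mul_eq_mul_left_iff] at hij
      exact Prod.ext (hij.1.resolve_right (by omega)) (hij.2.resolve_right (by omega))
  refine hstep.trans ?_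
  set G := ∑ i ∈ Finset.range (n + 2), (1 / 4 : ℝ) ^ i with hG
  have hG0 : 0 ≤ G := Finset.sum_nonneg fun _ _ => by positivity
  have hG1 : G ≤ 4 / 3 := sum_quarter_pow_le _
  have hGG : ∑ i ∈ Finset.range (n + 2) ×ˢ Finset.range (n + 2),
      (1 / 4 : ℝ) ^ i.1 * (1 / 4) ^ i.2 = G * G := by
    rw [hG, Finset.sum_mul_sum, Finset.sum_product]
  rw [← Finset.mul_sum]
  by_cases haa : 3 ≤ a + a'
  · have h1 : (1 / 2 : ℝ) ^ (a + a' - 2) ≤ 1 / 2 := by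
      calc (1 / 2 : ℝ) ^ (a + a' - 2) ≤ (1 / 2) ^ 1 :=
            pow_le_pow_of_le_one (by norm_num) (by norm_num) (by omega)
        _ = 1 / 2 := pow_one _
    have h2 : ∑ i ∈ P, (1 / 4 : ℝ) ^ i.1 * (1 / 4) ^ i.2 ≤ G * G := by
      rw [← hGG]
      exact Finset.sum_le_sum_of_subset_of_nonneg (Finset.filter_subset _ _)
        fun _ _ _ => by positivity
    have h3 : (0 : ℝ) ≤ ∑ i ∈ P, (1 / 4 : ℝ) ^ i.1 * (1 / 4) ^ i.2 :=
      Finset.sum_nonneg fun _ _ => by positivity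
    nlinarith
  · -- both least lengths are `1`, and the pair `(1, 1)` is not admissible
    have h2 : ∑ i ∈ P, (1 / 4 : ℝ) ^ i.1 * (1 / 4) ^ i.2 ≤ G * G - 1 := by
      have h3 : P ⊆ (Finset.range (n + 2) ×ˢ Finset.range (n + 2)).erase (0, 0) := by
        intro i hi
        rw [Finset.mem_erase]
        refine ⟨?_, (Finset.mem_filter.1 hi).1⟩
        rintro rfl
        have := (Finset.mem_filter.1 hi).2
        simp at this
        omega
      have h4 := Finset.add_sum_erase (Finset.range (n + 2) ×ˢ Finset.range (n + 2))
        (fun i => (1 / 4 : ℝ) ^ i.1 * (1 / 4) ^ i.2) (a := (0, 0)) (by simp)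
      rw [hGG] at h4
      simp only [pow_zero, mul_one] at h4
      have h5 := Finset.sum_le_sum_of_subset_of_nonneg h3
        (f := fun i => (1 / 4 : ℝ) ^ i.1 * (1 / 4) ^ i.2) fun _ _ _ => by positivity
      linarith
    rw [show a + a' - 2 = 0 by omega, pow_zero, one_mul]
    nlinarith

open Classical in
/-- The proportion of words with a nest of depth `N` at a given place decays exponentially: the nest
inside the outermost pair of blocks does not involve the letters of these blocks. -/
theorem card_isNest_le {g β : ℕ} (hg : 2 ≤ g) (hβ : β < g) (N : ℕ) {p q : ℕ} (hq : q ≤ n + 1) :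
    ((Finset.univ.filter fun x : Fin n → Bool => IsNest (extendWord x) g β N p q).card : ℝ) ≤
      (8 / 9) ^ N * 2 ^ n := by
  induction N generalizing p q with
  | zero =>
    rw [pow_zero, one_mul]
    exact_mod_cast (Finset.card_filter_le _ _).trans (by simp)
  | succ N ih =>
    -- the words whose outermost blocks have the lengths `b`
    let Q : ℕ × ℕ → (Fin n → Bool) → Prop := fun b x =>
      (IsNest (extendWord x) g β N (p + (b.1 + b.2)) (q - (b.1 + b.2)) ∧
        ∀ t < b.2 - 1, extendWord x (p + b.1 + t) = extendWord x (q - (b.1 + b.2) + t)) ∧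
        ∀ t < b.1 - 1, extendWord x (p + t) = extendWord x (q - b.1 + t)
    have hcard : ∀ b ∈ (blockPairs n g β).filter fun b => p + 2 * (b.1 + b.2) ≤ q,
        ((Finset.univ.filter (Q b)).card : ℝ) ≤
          (1 / 2) ^ (b.1 + b.2 - 2) * ((8 / 9) ^ N * 2 ^ n) := by
      intro b hb
      simp only [blockPairs, Finset.mem_filter] at hb
      obtain ⟨⟨-, hb1, hb2, -⟩, hpq⟩ := hb
      have h1 := two_pow_mul_card_filter_le (n := n)
        (fun x => IsNest (extendWord x) g β N (p + (b.1 + b.2)) (q - (b.1 + b.2)))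
        (l₀ := p + b.1) (r₀ := q - (b.1 + b.2)) (k := b.2 - 1) (by omega) (by omega)
        (fun r hr1 hr2 x hx => hx.congr fun i hi1 hi2 =>
          (extendWord_flipAt x (by omega)).symm)
      have h2 := two_pow_mul_card_filter_le (n := n)
        (fun x => IsNest (extendWord x) g β N (p + (b.1 + b.2)) (q - (b.1 + b.2)) ∧
          ∀ t < b.2 - 1, extendWord x (p + b.1 + t) = extendWord x (q - (b.1 + b.2) + t))
        (l₀ := p) (r₀ := q - b.1) (k := b.1 - 1) (by omega) (by omega)
        (fun r hr1 hr2 x hx => ⟨hx.1.congr fun i hi1 hi2 =>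
          (extendWord_flipAt x (by omega)).symm, fun t ht => by
            rw [extendWord_flipAt x (by omega), extendWord_flipAt x (by omega)]
            exact hx.2 t ht⟩)
      have h3 := (Nat.mul_le_mul_left (2 ^ (b.2 - 1)) h2).trans h1
      rw [← mul_assoc, ← pow_add, show b.2 - 1 + (b.1 - 1) = b.1 + b.2 - 2 by omega] at h3
      have h4 : (2 : ℝ) ^ (b.1 + b.2 - 2) * (Finset.univ.filter (Q b)).card ≤
          (8 / 9) ^ N * 2 ^ n := by
        refine le_trans ?_ (ih (p := p + (b.1 + b.2)) (q := q - (b.1 + b.2)) (by omega))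
        exact_mod_cast h3
      rw [one_div, inv_pow, ← div_eq_inv_mul, le_div_iff₀ (by positivity), mul_comm]
      exact h4
    have hsub : (Finset.univ.filter fun x : Fin n → Bool =>
        IsNest (extendWord x) g β (N + 1) p q) ⊆
        ((blockPairs n g β).filter fun b => p + 2 * (b.1 + b.2) ≤ q).biUnion fun b =>
          Finset.univ.filter (Q b) := by
      intro x hx
      obtain ⟨b, b', h1, h2, h3, h4, h5, h6, h7, h8, h9⟩ := (Finset.mem_filter.1 hx).2
      simp only [Finset.mem_biUnion, Finset.mem_filter, blockPairs, Finset.mem_product,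
        Finset.mem_range, Finset.mem_univ, true_and]
      exact ⟨(b, b'), ⟨⟨⟨by omega, by omega⟩, h1, h2, h3, h4, h5⟩, h6⟩,
        ⟨h9, fun t ht => h8 t (by omega)⟩, fun t ht => h7 t (by omega)⟩
    calc ((Finset.univ.filter fun x : Fin n → Bool =>
          IsNest (extendWord x) g β (N + 1) p q).card : ℝ)
        ≤ ∑ b ∈ (blockPairs n g β).filter fun b => p + 2 * (b.1 + b.2) ≤ q,
          ((Finset.univ.filter (Q b)).card : ℝ) := by
          exact_mod_cast (Finset.card_le_card hsub).trans Finset.card_biUnion_le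
      _ ≤ ∑ b ∈ (blockPairs n g β).filter fun b => p + 2 * (b.1 + b.2) ≤ q,
          (1 / 2) ^ (b.1 + b.2 - 2) * ((8 / 9) ^ N * 2 ^ n) := Finset.sum_le_sum hcard
      _ ≤ ∑ b ∈ blockPairs n g β, (1 / 2) ^ (b.1 + b.2 - 2) * ((8 / 9) ^ N * 2 ^ n) :=
          Finset.sum_le_sum_of_subset_of_nonneg (Finset.filter_subset _ _)
            fun _ _ _ => by positivity
      _ ≤ 8 / 9 * ((8 / 9) ^ N * 2 ^ n) := by
          rw [← Finset.sum_mul]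
          exact mul_le_mul_of_nonneg_right (sum_blockPairs_le n hg hβ) (by positivity)
      _ = (8 / 9) ^ (N + 1) * 2 ^ n := by ring

theorem two_pow_le_card_extensions (F : Finset (Fin n)) (y : Fin n → Bool) :
    2 ^ n ≤ 2 ^ F.card * (Finset.univ.filter fun x : Fin n → Bool => ∀ i ∈ F, x i = y i).card := by
  have h1 : (Finset.univ.filter fun x : Fin n → Bool => ∀ i ∈ F, x i = y i) =
      Fintype.piFinset fun i => if i ∈ F then {y i} else Finset.univ := by
    ext x
    simp only [Finset.mem_filter, Finset.mem_univ, true_and, Fintype.mem_piFinset]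
    refine forall_congr' fun i => ?_
    by_cases hi : i ∈ F <;> simp [hi]
  have h2 : 2 ^ F.card = ∏ i : Fin n, if i ∈ F then 2 else 1 := by
    rw [Finset.prod_ite, Finset.prod_const, Finset.prod_const_one, mul_one]
    simp
  have h3 : 2 ^ n = ∏ i : Fin n, 2 := by simp
  rw [h1, Fintype.card_piFinset, h2, h3, ← Finset.prod_mul_distrib]
  refine Finset.prod_le_prod' fun i _ => ?_
  by_cases hi : i ∈ F <;> simp [hi]

/-- By a union bound, few prescribed letters leave room for a word with distinct factors and without
deep nests. -/
theorem exists_generic_extension {ℓ c : ℕ} (hℓ : 2 * ℓ ≤ n)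
    (hsize : 2 * ((n : ℝ) + 2) ^ 4 * (8 / 9) ^ ℓ * 2 ^ c < 1) (F : Finset (Fin n))
    (hF : F.card ≤ c) (y : Fin n → Bool) :
    ∃ x : Fin n → Bool, (∀ i ∈ F, x i = y i) ∧ HasDistinctFactors ℓ n (extendWord x) ∧
      ∀ g β p q, 2 ≤ g → g ≤ 2 * ℓ → β < g → p ≤ q → q ≤ n + 1 →
        ¬ IsNest (extendWord x) g β ℓ p q := by
  classical
  by_contra! hcon
  let R := Finset.range (n + 2)
  let X := Finset.univ.filter fun x : Fin n → Bool => ∀ i ∈ F, x i = y i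
  let U : ℕ × ℕ → Finset (Fin n → Bool) := fun i => Finset.univ.filter fun x =>
    ∀ t < ℓ, extendWord x (i.1 + t) = extendWord x (i.2 + t)
  let V : ℕ × ℕ × ℕ × ℕ → Finset (Fin n → Bool) := fun i => Finset.univ.filter fun x =>
    IsNest (extendWord x) i.1 i.2.1 ℓ i.2.2.1 i.2.2.2
  let I := (R ×ˢ R).filter fun i => i.1 < i.2 ∧ i.2 + ℓ ≤ n
  let I' := (R ×ˢ R ×ˢ R ×ˢ R).filter fun i => 2 ≤ i.1 ∧ i.2.1 < i.1
  have hsub : X ⊆ I.biUnion U ∪ I'.biUnion V := by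
    intro x hx
    rw [Finset.mem_union]
    by_cases hx1 : HasDistinctFactors ℓ n (extendWord x)
    · right
      obtain ⟨g, β, p, q, h1, h2, h3, h4, h5, h6⟩ := hcon x (Finset.mem_filter.1 hx).2 hx1
      simp only [I', V, R, Finset.mem_biUnion, Finset.mem_filter, Finset.mem_product,
        Finset.mem_range, Finset.mem_univ, true_and]
      exact ⟨(g, β, p, q), ⟨⟨by omega, by dsimp only; omega, by dsimp only; omega,
        by dsimp only; omega⟩, h1, h3⟩, h6⟩
    · left
      unfold HasDistinctFactors at hx1
      push Not at hx1
      obtain ⟨i, j, h1, h2, h3⟩ := hx1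
      simp only [I, U, R, Finset.mem_biUnion, Finset.mem_filter, Finset.mem_product,
        Finset.mem_range, Finset.mem_univ, true_and]
      exact ⟨(i, j), ⟨⟨by omega, by omega⟩, h1, h2⟩, h3⟩
  have hU : ∀ i ∈ I, ((U i).card : ℝ) ≤ (8 / 9) ^ ℓ * 2 ^ n := by
    intro i hi
    have h1 := (Finset.mem_filter.1 hi).2
    have h2 := two_pow_mul_card_filter_le (n := n) (fun _ => True) h1.1 h1.2
      fun _ _ _ _ _ => trivial
    simp only [true_and, Finset.filter_true, Finset.card_univ, Fintype.card_fun, Fintype.card_bool,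
      Fintype.card_fin] at h2
    have h3 : (2 : ℝ) ^ ℓ * (U i).card ≤ 2 ^ n := by exact_mod_cast h2
    have h4 : ((U i).card : ℝ) ≤ (1 / 2) ^ ℓ * 2 ^ n := by
      rw [one_div, inv_pow, ← div_eq_inv_mul, le_div_iff₀ (by positivity), mul_comm]
      exact h3
    refine h4.trans (mul_le_mul_of_nonneg_right ?_ (by positivity))
    exact pow_le_pow_left₀ (by norm_num) (by norm_num) _
  have hV : ∀ i ∈ I', ((V i).card : ℝ) ≤ (8 / 9) ^ ℓ * 2 ^ n := by
    intro i hi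
    simp only [I', R, Finset.mem_filter, Finset.mem_product, Finset.mem_range] at hi
    exact card_isNest_le hi.2.1 hi.2.2 ℓ (by omega)
  have hn1 : (1 : ℝ) ≤ n + 2 := by
    have : (0 : ℝ) ≤ n := Nat.cast_nonneg n
    linarith
  have hI : (I.card : ℝ) ≤ ((n : ℝ) + 2) ^ 4 := by
    have h1 : I.card ≤ (n + 2) ^ 2 := (Finset.card_filter_le _ _).trans (by
      rw [Finset.card_product, Finset.card_range, pow_two])
    calc (I.card : ℝ) ≤ ((n : ℝ) + 2) ^ 2 := by exact_mod_cast h1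
      _ ≤ ((n : ℝ) + 2) ^ 4 := pow_le_pow_right₀ hn1 (by norm_num)
  have hI' : (I'.card : ℝ) ≤ ((n : ℝ) + 2) ^ 4 := by
    have h1 : I'.card ≤ (n + 2) ^ 4 := (Finset.card_filter_le _ _).trans (by
      rw [Finset.card_product, Finset.card_product, Finset.card_product, Finset.card_range]
      exact le_of_eq (by ring))
    exact_mod_cast h1
  have hX : (X.card : ℝ) ≤ 2 * ((n : ℝ) + 2) ^ 4 * ((8 / 9) ^ ℓ * 2 ^ n) := by
    have h1 : X.card ≤ ∑ i ∈ I, (U i).card + ∑ i ∈ I', (V i).card :=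
      (Finset.card_le_card hsub).trans ((Finset.card_union_le _ _).trans
        (add_le_add Finset.card_biUnion_le Finset.card_biUnion_le))
    have h2 : (X.card : ℝ) ≤ ∑ i ∈ I, ((U i).card : ℝ) + ∑ i ∈ I', ((V i).card : ℝ) := by
      exact_mod_cast h1
    have h3 := Finset.sum_le_card_nsmul I _ _ hU
    have h4 := Finset.sum_le_card_nsmul I' _ _ hV
    rw [nsmul_eq_mul] at h3 h4
    have h5 : (0 : ℝ) ≤ (8 / 9) ^ ℓ * 2 ^ n := by positivity
    have h6 := mul_le_mul_of_nonneg_right hI h5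
    have h7 := mul_le_mul_of_nonneg_right hI' h5
    linarith
  have hlow : (2 : ℝ) ^ n ≤ 2 ^ c * X.card := by
    have h1 := two_pow_le_card_extensions F y
    have h2 : 2 ^ n ≤ 2 ^ c * X.card :=
      h1.trans (Nat.mul_le_mul_right _ (Nat.pow_le_pow_right (by norm_num) hF))
    exact_mod_cast h2
  have h1 : (2 : ℝ) ^ n ≤ (2 * ((n : ℝ) + 2) ^ 4 * (8 / 9) ^ ℓ * 2 ^ c) * 2 ^ n := by
    calc (2 : ℝ) ^ n ≤ 2 ^ c * X.card := hlow
      _ ≤ 2 ^ c * (2 * ((n : ℝ) + 2) ^ 4 * ((8 / 9) ^ ℓ * 2 ^ n)) :=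
          mul_le_mul_of_nonneg_left hX (by positivity)
      _ = _ := by ring
  have h2 : (0 : ℝ) < 2 ^ n := by positivity
  have h3 := mul_lt_mul_of_pos_right hsize h2
  linarith

end Count

/-- A parameter `ℓ` of the order of the tenth root of `n` satisfies all requirements. -/
theorem exists_parameter (c : ℕ) : ∃ n₀ : ℕ, ∀ n : ℕ, n₀ ≤ n → ∃ ℓ, 0 < ℓ ∧ 2 * ℓ ≤ n ∧
    (2 * (2 * ℓ * (2 * (2 * ℓ + 1))) + 1) ^ 2 * (20 * ℓ ^ 3) + 2 * (2 * ℓ * (2 * (2 * ℓ + 1))) ≤ n ∧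
      2 * ((n : ℝ) + 2) ^ 4 * (8 / 9) ^ ℓ * 2 ^ c < 1 := by
  have hlim := (tendsto_pow_const_mul_const_pow_of_abs_lt_one 40
    (r := (8 / 9 : ℝ)) (by rw [abs_of_pos] <;> norm_num)).const_mul
    ((2 : ℝ) * 3 ^ 4 * 2 ^ 40 * 2 ^ c)
  rw [mul_zero] at hlim
  obtain ⟨L, hL⟩ := Filter.eventually_atTop.1 (hlim.eventually_lt_const one_pos)
  refine ⟨(max L 24) ^ 10, fun n hn => ?_⟩
  -- the integral part of the tenth root
  obtain ⟨ℓ, hℓ1, hℓ2, hℓ3⟩ : ∃ ℓ, max L 24 ≤ ℓ ∧ ℓ ^ 10 ≤ n ∧ n < (ℓ + 1) ^ 10 := by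
    have hn0 : max L 24 ≤ n := (Nat.le_self_pow (by norm_num) _).trans hn
    have hspec := Nat.findGreatest_spec (P := fun k => k ^ 10 ≤ n) hn0 hn
    refine ⟨Nat.findGreatest (fun k => k ^ 10 ≤ n) n,
      Nat.le_findGreatest (P := fun k => k ^ 10 ≤ n) hn0 hn, hspec, ?_⟩
    by_contra! hc
    have := Nat.le_findGreatest (P := fun k => k ^ 10 ≤ n)
      ((Nat.le_self_pow (by norm_num) _).trans hc) hc
    omega
  have hℓL : L ≤ ℓ := (le_max_left _ _).trans hℓ1
  have hℓ24 : 24 ≤ ℓ := (le_max_right _ _).trans hℓ1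
  have e2 : ℓ ≤ ℓ ^ 2 := Nat.le_self_pow (by norm_num) _
  have e7 : ℓ ^ 2 ≤ ℓ ^ 7 := Nat.pow_le_pow_right (by omega) (by norm_num)
  have e10 : 24 ^ 3 * ℓ ^ 7 ≤ ℓ ^ 10 := by
    calc 24 ^ 3 * ℓ ^ 7 ≤ ℓ ^ 3 * ℓ ^ 7 := Nat.mul_le_mul_right _ (Nat.pow_le_pow_left hℓ24 3)
      _ = ℓ ^ 10 := by ring
  refine ⟨ℓ, by omega, by omega, ?_, ?_⟩
  · set K := 2 * (2 * ℓ * (2 * (2 * ℓ + 1))) with hK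
    have hK' : K + 1 ≤ 25 * ℓ ^ 2 := by
      have : K = 16 * ℓ ^ 2 + 8 * ℓ := by rw [hK]; ring
      omega
    have h1 : (K + 1) ^ 2 * (20 * ℓ ^ 3) ≤ 12500 * ℓ ^ 7 := by
      calc (K + 1) ^ 2 * (20 * ℓ ^ 3) ≤ (25 * ℓ ^ 2) ^ 2 * (20 * ℓ ^ 3) :=
            Nat.mul_le_mul_right _ (Nat.pow_le_pow_left hK' 2)
        _ = 12500 * ℓ ^ 7 := by ring
    omega
  · have h1 : (n : ℝ) + 2 ≤ 3 * 2 ^ 10 * (ℓ : ℝ) ^ 10 := by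
      have h2 : n + 2 ≤ 3 * (2 ^ 10 * ℓ ^ 10) := by
        have h3 : (ℓ + 1) ^ 10 ≤ 2 ^ 10 * ℓ ^ 10 := by
          rw [← mul_pow]
          exact Nat.pow_le_pow_left (by omega) 10
        omega
      rw [mul_assoc]
      exact_mod_cast h2
    have h4 : ((n : ℝ) + 2) ^ 4 ≤ (3 * 2 ^ 10 * (ℓ : ℝ) ^ 10) ^ 4 :=
      pow_le_pow_left₀ (by positivity) h1 4
    calc 2 * ((n : ℝ) + 2) ^ 4 * (8 / 9) ^ ℓ * 2 ^ c
        ≤ 2 * (3 * 2 ^ 10 * (ℓ : ℝ) ^ 10) ^ 4 * (8 / 9) ^ ℓ * 2 ^ c := by gcongr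
      _ = 2 * 3 ^ 4 * 2 ^ 40 * 2 ^ c * ((ℓ : ℝ) ^ 40 * (8 / 9) ^ ℓ) := by ring
      _ < 1 := hL ℓ hℓL

/-! ### Circuits and certificates -/

/-- An accepting computation of a circuit of depth `d` uses at most `2 ^ d` input bits, since AND
gates have fan-in two and one input suffices for an OR gate. -/
theorem SACCircuit.exists_certificate {n : ℕ} (C : SACCircuit n) (x : Fin n → Bool)
    (k : Fin C.size) (h : C.Holds x k) :
    ∃ F : Finset (Fin n), F.card ≤ 2 ^ C.gateDepth k ∧
      ∀ y : Fin n → Bool, (∀ i ∈ F, y i = x i) → C.Holds y k := by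
  classical
  obtain ⟨k, hk⟩ := k
  induction k using Nat.strong_induction_on with
  | _ k ih =>
    rw [SACCircuit.gateDepth]
    rw [SACCircuit.Holds] at h
    simp only [SACCircuit.Holds.eq_1 C _ ⟨k, hk⟩]
    cases hg : C.gate ⟨k, hk⟩ with
    | const b =>
      simp only [hg] at h ⊢
      exact ⟨∅, by simp, fun _ _ => h⟩
    | input i =>
      simp only [hg] at h ⊢
      exact ⟨{i}, by simp, fun y hy => (hy i (by simp)).trans h⟩
    | negInput i =>
      simp only [hg] at h ⊢
      exact ⟨{i}, by simp, fun y hy => (hy i (by simp)).trans h⟩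
    | and a b =>
      simp only [hg] at h ⊢
      obtain ⟨F, hF, hF'⟩ := ih a a.2 _ h.1
      obtain ⟨G, hG, hG'⟩ := ih b b.2 _ h.2
      refine ⟨F ∪ G, (Finset.card_union_le _ _).trans ?_, fun y hy =>
        ⟨hF' y fun i hi => hy i (Finset.mem_union_left _ hi),
          hG' y fun i hi => hy i (Finset.mem_union_right _ hi)⟩⟩
      rw [pow_succ, mul_two]
      exact add_le_add
        (hF.trans (Nat.pow_le_pow_right (by norm_num) (le_max_left _ _)))
        (hG.trans (Nat.pow_le_pow_right (by norm_num) (le_max_right _ _)))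
    | or S =>
      simp only [hg] at h ⊢
      obtain ⟨a, ha, h⟩ := h
      obtain ⟨F, hF, hF'⟩ := ih a a.2 _ h
      refine ⟨F, hF.trans (Nat.pow_le_pow_right (by norm_num) ?_), fun y hy => ⟨a, ha, hF' y hy⟩⟩
      exact (Finset.le_sup (f := fun a : Fin k => C.gateDepth ⟨a, a.2.trans hk⟩) ha).trans
        (Nat.le_succ _)

/-- If boundedly many prescribed letters never force a long word into `P`, the languages in `SAC⁰`
contained in `P` are finite. -/
theorem finite_of_mem_SAC0 {S P : Set (List Bool)} (hS : S ∈ SAC0) (hSP : S ⊆ P)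
    (hP : ∀ c : ℕ, ∃ n₀ : ℕ, ∀ n : ℕ, n₀ ≤ n → ∀ F : Finset (Fin n), F.card ≤ c →
      ∀ y : Fin n → Bool, ∃ x : Fin n → Bool, (∀ i ∈ F, x i = y i) ∧ List.ofFn x ∉ P) :
    S.Finite := by
  obtain ⟨d, e, C, hC, hCS⟩ := hS
  obtain ⟨n₀, hn₀⟩ := hP (2 ^ d)
  refine (List.finite_length_lt Bool n₀).subset fun l hl => ?_
  by_contra hlen
  simp only [Set.mem_ofPred_eq, not_lt] at hlen
  obtain ⟨F, hF, hF'⟩ := (C l.length).exists_certificate l.get _ ((hCS l).1 hl)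
  obtain ⟨x, hx, hxP⟩ := hn₀ _ hlen F
    (hF.trans (Nat.pow_le_pow_right (by norm_num) (hC _).1)) l.get
  refine hxP (hSP ((hCS _).2 ?_))
  have hcast : ∀ (m : ℕ) (z : Fin m → Bool), m = l.length → (∀ i : Fin m, ∀ j : Fin l.length,
      i.val = j.val → z i = x j) → (C m).Accepts z := by
    rintro m z rfl hz
    exact hF' z fun i hi => (hz i i rfl).trans (hx i hi)
  refine hcast _ _ List.length_ofFn fun i j hij => ?_
  rw [List.get_ofFn]
  exact congrArg x (Fin.ext hij)

theorem testBit_eq_true_of_le_of_lt {a k : ℕ} (h : 2 ^ k ≤ a) (h' : a < 2 ^ (k + 1)) :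
    a.testBit k = true := by
  have : a / 2 ^ k = 1 := by
    rw [Nat.div_eq_iff (by positivity)]
    rw [pow_succ] at h'
    omega
  rw [Nat.testBit_eq_decide_div_mod_eq, this]
  rfl

/-! ### Words of small complexity with prescribed letters -/

/-- Few positions are pairwise incongruent modulo some number between `n / 8` and `n / 4`, since
each difference has few divisors in this range. -/
theorem exists_period {n c : ℕ} (hn : 64 * c ^ 2 + 64 ≤ n) (F : Finset (Fin n)) (hF : F.card ≤ c) :
    ∃ k, 0 < k ∧ k ≤ n / 4 ∧ ∀ i ∈ F, ∀ j ∈ F, i.val % k = j.val % k → i = j := by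
  classical
  let D : Fin n × Fin n → Finset ℕ := fun i =>
    (Finset.Ioc (n / 8) (n / 4)).filter fun k => i.1 < i.2 ∧ k ∣ i.2.val - i.1.val
  have hD : ∀ i ∈ F ×ˢ F, (D i).card ≤ 8 := by
    intro i _
    rw [← Finset.card_range 8]
    refine Finset.card_le_card_of_injOn (fun k => (i.2.val - i.1.val) / k) ?_ ?_
    · intro k hk
      simp only [D, Finset.coe_filter, Finset.mem_Ioc, Set.mem_ofPred_eq] at hk
      rw [Finset.coe_range, Set.mem_Iio, Nat.div_lt_iff_lt_mul (by omega)]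
      omega
    · intro k hk k' hk' heq
      simp only [D, Finset.coe_filter, Finset.mem_Ioc, Set.mem_ofPred_eq] at hk hk'
      obtain ⟨a, ha⟩ := hk.2.2
      obtain ⟨a', ha'⟩ := hk'.2.2
      have hlt : i.1.val < i.2.val := hk.2.1
      simp only at heq
      rw [Nat.div_eq_of_eq_mul_right (by omega) ha,
        Nat.div_eq_of_eq_mul_right (by omega) ha'] at heq
      subst heq
      rw [ha] at ha'
      have : a ≠ 0 := by
        rintro rfl
        omega
      exact Nat.eq_of_mul_eq_mul_right (Nat.pos_of_ne_zero this) ha'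
  have hcard : ((F ×ˢ F).biUnion D).card < (Finset.Ioc (n / 8) (n / 4)).card := by
    have h1 := Finset.card_biUnion_le_card_mul _ _ 8 hD
    rw [Finset.card_product] at h1
    have h2 : F.card * F.card ≤ c ^ 2 := by
      rw [pow_two]
      exact Nat.mul_le_mul hF hF
    rw [Nat.card_Ioc]
    omega
  obtain ⟨k, hk, hkD⟩ := Finset.exists_mem_notMem_of_card_lt_card hcard
  rw [Finset.mem_Ioc] at hk
  have key : ∀ i ∈ F, ∀ j ∈ F, i.val % k = j.val % k → ¬ i < j := by
    intro i hi j hj hij hlt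
    apply hkD
    rw [Finset.mem_biUnion]
    refine ⟨(i, j), Finset.mem_product.2 ⟨hi, hj⟩, ?_⟩
    simp only [D, Finset.mem_filter, Finset.mem_Ioc]
    exact ⟨hk, hlt, (Nat.modEq_iff_dvd' (Fin.le_def.1 hlt.le)).1 hij⟩
  refine ⟨k, by omega, hk.2, fun i hi j hj hij => ?_⟩
  exact le_antisymm (not_lt.1 (key j hj i hi hij.symm)) (not_lt.1 (key i hi j hj hij))

theorem exists_extension_notMem_msbProblem (c : ℕ) : ∃ n₀ : ℕ, ∀ n : ℕ, n₀ ≤ n →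
    ∀ F : Finset (Fin n), F.card ≤ c → ∀ y : Fin n → Bool, ∃ x : Fin n → Bool,
      (∀ i ∈ F, x i = y i) ∧ List.ofFn x ∉ msbProblem := by
  classical
  refine ⟨64 * c ^ 2 + 64, fun n hn F hF y => ?_⟩
  obtain ⟨k, hk0, hkn, hk⟩ := exists_period hn F hF
  let f : ℕ → Bool := fun r => if h : ∃ j ∈ F, j.val % k = r then y h.choose else false
  refine ⟨fun i => f (i % k), fun i hi => ?_, ?_⟩
  · have hex : ∃ j ∈ F, j.val % k = i.val % k := ⟨i, hi, rfl⟩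
    simp only [f]
    rw [dif_pos hex]
    exact congrArg y (hk _ hex.choose_spec.1 _ hi hex.choose_spec.2)
  · have hA : automaticComplexity (List.ofFn fun i : Fin n => f (i % k)) ≤ k :=
      automaticComplexity_le_of_periodic _ k hk0 f fun i => by
        rw [List.get_ofFn]
        rfl
    have hlt := Nat.lt_pow_succ_log_self (b := 2) (by norm_num) (n / 2 + 1)
    rw [pow_succ] at hlt
    simp only [msbProblem, Set.mem_ofPred_eq, List.length_ofFn]
    rw [Nat.testBit_lt_two_pow (by omega)]
    simp

/-! ### Words of maximal complexity with prescribed letters -/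

theorem IsWitness.exists_isUniquePath {α σ : Type*} {M : NFA α σ} {x : List α}
    (h : IsWitness M x) (w : ℕ → α) (hw : ∀ i : Fin x.length, x.get i = w i) :
    ∃ s : ℕ → σ, IsUniquePath (fun p a r => r ∈ M.step p a) x.length s w := by
  obtain ⟨⟨q₀, hq₀⟩, s, ⟨h0, h1, h2⟩, huniq⟩ := h
  refine ⟨fun i => s ⟨min i x.length, by omega⟩, fun i hi => ?_, fun s' w' e0 en hstep => ?_⟩
  · have h3 := h2 ⟨i, hi⟩
    rw [hw] at h3
    have e1 : (⟨min i x.length, by omega⟩ : Fin (x.length + 1)) = (⟨i, hi⟩ : Fin _).castSucc :=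
      Fin.ext (by simp; omega)
    have e2 : (⟨min (i + 1) x.length, by omega⟩ : Fin (x.length + 1)) = (⟨i, hi⟩ : Fin _).succ :=
      Fin.ext (by simp; omega)
    simp only [e1, e2]
    exact h3
  · have hacc : IsAcceptingPath M x.length (fun i => s' i) fun i => w' i := by
      refine ⟨?_, ?_, fun i => ?_⟩
      · have e : s' ((0 : Fin (x.length + 1)) : ℕ) = s 0 := by simpa using e0
        rw [← e] at h0
        exact h0
      · have e : s' ((Fin.last x.length : Fin (x.length + 1)) : ℕ) = s (Fin.last _) := by
          simpa [Fin.last] using en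
        rw [← e] at h1
        exact h1
      · simpa using hstep i i.2
    obtain ⟨e1, e2⟩ := huniq _ _ hacc
    constructor
    · intro i hi
      have := congrFun e1 ⟨i, by omega⟩
      simp only at this
      rw [this]
      congr 2
      omega
    · intro i hi
      have := congrFun e2 ⟨i, hi⟩
      simp only at this
      rw [this, hw]

/-- A word with distinct factors and no deep nests has the maximal complexity. -/
theorem automaticComplexity_eq_of_generic {n ℓ : ℕ} (hℓ : 0 < ℓ) {K : ℕ}
    (hK : K = 2 * (2 * ℓ * (2 * (2 * ℓ + 1)))) (hsize : (K + 1) ^ 2 * (20 * ℓ ^ 3) + K ≤ n)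
    {x : Fin n → Bool} (hU : HasDistinctFactors ℓ n (extendWord x))
    (hnest : ∀ g β p q, 2 ≤ g → g ≤ 2 * ℓ → β < g → p ≤ q → q ≤ n + 1 →
      ¬ IsNest (extendWord x) g β ℓ p q) :
    automaticComplexity (List.ofFn x) = n / 2 + 1 := by
  apply le_antisymm
  · have := automaticComplexity_le_half (List.ofFn x)
    rwa [List.length_ofFn] at this
  · obtain ⟨M, hM⟩ := exists_isWitness_automaticComplexity (List.ofFn x)
    obtain ⟨s, hs⟩ := hM.exists_isUniquePath (extendWord x) fun i => by
      have hi : i.val < n := by simpa using i.2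
      rw [List.get_ofFn, extendWord, dif_pos hi]
      rfl
    rw [List.length_ofFn] at hs
    have := hs.le_two_mul_card hU hℓ hK hsize hnest
    rw [Fintype.card_fin] at this
    omega

theorem exists_extension_mem_msbProblem (c : ℕ) : ∃ n₀ : ℕ, ∀ n : ℕ, n₀ ≤ n →
    ∀ F : Finset (Fin n), F.card ≤ c → ∀ y : Fin n → Bool, ∃ x : Fin n → Bool,
      (∀ i ∈ F, x i = y i) ∧ List.ofFn x ∈ msbProblem := by
  obtain ⟨n₀, hn₀⟩ := exists_parameter c
  refine ⟨n₀, fun n hn F hF y => ?_⟩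
  obtain ⟨ℓ, hℓ, hℓn, hsize, hsize'⟩ := hn₀ n hn
  obtain ⟨x, hxy, hU, hnest⟩ := exists_generic_extension hℓn hsize' F hF y
  refine ⟨x, hxy, ?_⟩
  simp only [msbProblem, Set.mem_ofPred_eq, List.length_ofFn]
  rw [automaticComplexity_eq_of_generic hℓ rfl hsize hU hnest]
  exact testBit_eq_true_of_le_of_lt (Nat.pow_log_le_self 2 (by omega))
    (Nat.lt_pow_succ_log_self (by norm_num) _)

/-! ### Immunity -/

theorem infinite_of_forall_exists_ofFn_mem {P : Set (List Bool)} {n₀ : ℕ}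
    (h : ∀ n : ℕ, n₀ ≤ n → ∃ x : Fin n → Bool, List.ofFn x ∈ P) : P.Infinite := by
  refine Set.Infinite.of_image List.length (Set.infinite_of_forall_exists_gt fun n => ?_)
  obtain ⟨x, hx⟩ := h (max n₀ (n + 1)) (le_max_left _ _)
  refine ⟨_, ⟨_, hx, rfl⟩, ?_⟩
  rw [List.length_ofFn]
  omega

theorem isImmune_msbProblem : IsImmune SAC0 msbProblem := by
  refine ⟨?_, fun S hS hSP => finite_of_mem_SAC0 hS hSP exists_extension_notMem_msbProblem⟩
  obtain ⟨n₀, hn₀⟩ := exists_extension_mem_msbProblem 0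
  refine infinite_of_forall_exists_ofFn_mem (n₀ := n₀) fun n hn => ?_
  obtain ⟨x, -, hx⟩ := hn₀ n hn ∅ le_rfl fun _ => false
  exact ⟨x, hx⟩

theorem isCoimmune_msbProblem : IsCoimmune SAC0 msbProblem := by
  refine ⟨?_, fun S hS hSP => finite_of_mem_SAC0 hS hSP fun c => ?_⟩
  · obtain ⟨n₀, hn₀⟩ := exists_extension_notMem_msbProblem 0
    refine infinite_of_forall_exists_ofFn_mem (n₀ := n₀) fun n hn => ?_
    obtain ⟨x, -, hx⟩ := hn₀ n hn ∅ le_rfl fun _ => false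
    exact ⟨x, hx⟩
  · obtain ⟨n₀, hn₀⟩ := exists_extension_mem_msbProblem c
    refine ⟨n₀, fun n hn F hF y => ?_⟩
    obtain ⟨x, hxy, hx⟩ := hn₀ n hn F hF y
    exact ⟨x, hxy, fun h => h hx⟩

theorem mainTheorem2 :
    (IsImmune SAC0 msbProblem ∧ IsCoimmune SAC0 msbProblem) ∧
      msbProblem ∉ SAC0 ∧ msbProblem ∉ coSAC0 :=
  ⟨⟨isImmune_msbProblem, isCoimmune_msbProblem⟩,
    fun h => isImmune_msbProblem.1 (isImmune_msbProblem.2 _ h subset_rfl),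
    fun h => isCoimmune_msbProblem.1 (isCoimmune_msbProblem.2 _ h subset_rfl)⟩
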